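/- **Theorem 4 (Learning by Self-Aware Receiving Agents).** *Network.* Consider finitely many agents, partitioned into sending sub-networks $1,\dots,S$ and receiving sub-networks $S+1,\dots,S+R$, with $N_{gS}$ sending and $N_{gR}$ receiving agents in total. Let $A=(a_{\ell k})$ be a matrix with $a_{\ell k}\ge 0$ and $\sum_\ell a_{\ell k}=1$ for every $k$, where $a_{\ell k}$ is the weight that agent $k$ gives to agent $\ell$. Listing the sending agents first, $$A=\begin{bmatrix}T_{SS}&T_{SR}\\0&T_{RR}\end{bmatrix},$$ where $T_{SS}$ is block diagonal with one block per sending sub-network and $T_{RR}$ is block upper triangular with one diagonal block per receiving sub-network. Each sending sub-network is strongly connected (a directed path of positive internal weights joins any two of its agents, and $a_{kk}>0$ for at least one of its agents $k$). In each receiving sub-network a directed path of positive internal weights joins any two agents, and at least one of its agents gives positive weight to an agent outside of it. *Model.* Let $\Theta$ be a finite set of states. Agent $k$ has a finite signal space $Z_k$ and likelihoods $L_k(\cdot|\theta)$, a probability mass function on $Z_k$ for each $\theta\in\Theta$. Each sub-network $j$ has its own true state $\theta_j^\circ\in\Theta$. At each time $i\ge1$ each agent $k$ of sub-network $j$ observes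 a signal $\boldsymbol\xi_{k,i}$ distributed according to $L_k(\cdot|\theta^\circ_j)$; the signal vectors $(\boldsymbol\xi_{k,i})_k$ are independent over $i$. Starting from prior probability distributions $\mu_{k,0}$ on $\Theta$, with weights $\gamma_{k,i}\in[0,1]$, the beliefs follow the self-aware diffusion model $$\boldsymbol\psi_{k,i}(\theta)=(1-\gamma_{k,i})\boldsymbol\mu_{k,i-1}(\theta)+\gamma_{k,i}\frac{\boldsymbol\mu_{k,i-1}(\theta)L_k(\boldsymbol\xi_{k,i}|\theta)}{\sum_{\theta'\in\Theta}\boldsymbol\mu_{k,i-1}(\theta')L_k(\boldsymbol\xi_{k,i}|\theta')},\qquad \boldsymbol\mu_{k,i}(\theta)=\sum_{\ell}a_{\ell k}\boldsymbol\psi_{\ell,i}(\theta)$$ (a fraction with zero denominator counts as $0$). Let $\boldsymbol\mu_{\mathcal S,i}(\theta)$ and $\boldsymbol\mu_{\mathcal R,i}(\theta)$ collect the beliefs at $\theta$ of the sending and of the receiving agents. *Claim.* The matrix $I-T_{RR}$ is invertible. Put $W=T_{SR}(I-T_{RR})^{-1}$ and $C=(I-T_{RR}^{\mathsf T})^{-1}$,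 and consider the elementwise inequalities $$\limsup_{i\to\infty}\boldsymbol\mu_{\mathcal R,i}(\theta)\preceq W^{\mathsf T}\Big(\lim_{i\to\infty}\boldsymbol\mu_{\mathcal S,i}(\theta)\Big)+\gamma_{\max}C\mathbb 1_{N_{gR}},\qquad \liminf_{i\to\infty}\boldsymbol\mu_{\mathcal R,i}(\theta)\succeq W^{\mathsf T}\Big(\lim_{i\to\infty}\boldsymbol\mu_{\mathcal S,i}(\theta)\Big)-\gamma_{\max}C\mathbb 1_{N_{gR}}.\tag{$*$}$$ 1. If $\gamma_{k,i}\le\gamma_{\max}$ for all agents $k$ and all $i\ge1$, then $(*)$ holds for every $\theta\in\Theta$ and every realization of the signals for which $\lim_{i}\boldsymbol\mu_{\mathcal S,i}(\theta)$ exists. 2. For an agent $k$ of a sending sub-network $s$ let $\Theta_k=\{\theta\in\Theta: L_k(\zeta|\theta)=L_k(\zeta|\theta_s^\circ)\ \forall\zeta\in Z_k\}$. Assume for every sending sub-network $s$ that $\mu_{k,0}(\theta_s^\circ)>0$ for some agent $k$ of $s$; that $\bigcap_{k\in s}\Theta_k=\{\theta_s^\circ\}$; that each agent $k$ of $s$ has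 a prevailing signal, that is, some $\zeta_k^\circ\in Z_k$ with $L_k(\zeta_k^\circ|\theta)<L_k(\zeta_k^\circ|\theta_s^\circ)$ for all $\theta\in\Theta\setminus\Theta_k$; and that $\liminf_{i\to\infty}\gamma_{k,i}>0$ for each agent $k$ of $s$. If $\gamma_{k,i}\le\gamma_{\max}$ for all receiving agents $k$ and all $i\ge1$, then almost surely, for every $\theta\in\Theta$, $\lim_i\boldsymbol\mu_{\mathcal S,i}(\theta)$ exists, its entry at each agent of sending sub-network $s$ being $1$ if $\theta=\theta_s^\circ$ and $0$ otherwise, and $(*)$ holds. No relation is assumed between the true states of the sending sub-networks and the likelihoods of the receiving agents. -/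

import Mathlib

open Filter Topology MeasureTheory ProbabilityTheory

open scoped Matrix

/-- The agents of the sending sub-networks: sub-network `s` has `NS s` agents. -/
abbrev SAgent {S : ℕ} (NS : Fin S → ℕ) : Type := (s : Fin S) × Fin (NS s)

/-- The agents of the receiving sub-networks: sub-network `r` has `NR r` agents. -/
abbrev RAgent {R : ℕ} (NR : Fin R → ℕ) : Type := (r : Fin R) × Fin (NR r)

/-- All agents: first the sending ones, then the receiving ones. -/
abbrev Agent {S R : ℕ} (NS : Fin S → ℕ) (NR : Fin R → ℕ) : Type := SAgent NS ⊕ RAgent NR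

/-- Any two agents are joined, in both directions, by a directed path along strictly positive
weights (`M l k` is the weight with which agent `k` scales the data arriving from `l`). -/
def IsPathConnectedNet {ι : Type*} (M : Matrix ι ι ℝ) : Prop :=
  ∀ l k : ι, Relation.ReflTransGen (fun a b => 0 < M a b) l k

/-- A strongly-connected network: a path joins any two agents, and there is a self-loop. -/
def IsStronglyConnectedNet {ι : Type*} (M : Matrix ι ι ℝ) : Prop :=
  IsPathConnectedNet M ∧ ∃ k : ι, 0 < M k k

/-- The diagonal block of sending sub-network `s`. -/
def sendBlock {S R : ℕ} {NS : Fin S → ℕ} {NR : Fin R → ℕ}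
    (A : Matrix (Agent NS NR) (Agent NS NR) ℝ) (s : Fin S) :
    Matrix (Fin (NS s)) (Fin (NS s)) ℝ :=
  A.submatrix (fun n => Sum.inl ⟨s, n⟩) (fun n => Sum.inl ⟨s, n⟩)

/-- The diagonal block of receiving sub-network `r`. -/
def recvBlock {S R : ℕ} {NS : Fin S → ℕ} {NR : Fin R → ℕ}
    (A : Matrix (Agent NS NR) (Agent NS NR) ℝ) (r : Fin R) :
    Matrix (Fin (NR r)) (Fin (NR r)) ℝ :=
  A.submatrix (fun n => Sum.inr ⟨r, n⟩) (fun n => Sum.inr ⟨r, n⟩)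

/-- `A` is the combination matrix of a weakly-connected network. -/
structure IsWeakNetwork {S R : ℕ} {NS : Fin S → ℕ} {NR : Fin R → ℕ}
    (A : Matrix (Agent NS NR) (Agent NS NR) ℝ) : Prop where
  nonneg : ∀ l k, 0 ≤ A l k
  /-- left-stochasticity: every column adds up to one -/
  col_sum : ∀ k, ∑ l, A l k = 1
  /-- no information flows from receiving to sending agents -/
  recv_to_send : ∀ (l : RAgent NR) (k : SAgent NS), A (Sum.inr l) (Sum.inl k) = 0
  /-- distinct sending sub-networks do not communicate -/
  send_to_send : ∀ l k : SAgent NS, l.1 ≠ k.1 → A (Sum.inl l) (Sum.inl k) = 0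
  /-- among the receiving sub-networks the matrix is block upper triangular -/
  recv_triangular : ∀ l k : RAgent NR, k.1 < l.1 → A (Sum.inr l) (Sum.inr k) = 0
  send_connected : ∀ s : Fin S, IsStronglyConnectedNet (sendBlock A s)
  recv_connected : ∀ r : Fin R, IsPathConnectedNet (recvBlock A r)
  /-- every receiving sub-network receives information from outside of itself -/
  recv_fed : ∀ r : Fin R, ∃ (n : Fin (NR r)) (l : Agent NS NR),
    (∀ m : Fin (NR r), l ≠ Sum.inr ⟨r, m⟩) ∧ 0 < A l (Sum.inr ⟨r, n⟩)

/-- The block `T_SR`: weights from sending to receiving agents. -/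
def blockSR {S R : ℕ} {NS : Fin S → ℕ} {NR : Fin R → ℕ}
    (A : Matrix (Agent NS NR) (Agent NS NR) ℝ) : Matrix (SAgent NS) (RAgent NR) ℝ :=
  A.toBlocks₁₂

/-- The block `T_RR`: weights among receiving agents. -/
def blockRR {S R : ℕ} {NS : Fin S → ℕ} {NR : Fin R → ℕ}
    (A : Matrix (Agent NS NR) (Agent NS NR) ℝ) : Matrix (RAgent NR) (RAgent NR) ℝ :=
  A.toBlocks₂₂

/-- `W = T_SR (I - T_RR)⁻¹`. -/
noncomputable def matrixW {S R : ℕ} {NS : Fin S → ℕ} {NR : Fin R → ℕ}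
    (A : Matrix (Agent NS NR) (Agent NS NR) ℝ) : Matrix (SAgent NS) (RAgent NR) ℝ :=
  blockSR A * (1 - blockRR A)⁻¹

/-- `C = (I - T_RRᵀ)⁻¹`. -/
noncomputable def matrixC {S R : ℕ} {NS : Fin S → ℕ} {NR : Fin R → ℕ}
    (A : Matrix (Agent NS NR) (Agent NS NR) ℝ) : Matrix (RAgent NR) (RAgent NR) ℝ :=
  (1 - (blockRR A)ᵀ)⁻¹

/-- A nonnegative weight function on a finite type with total mass one. -/
def IsProbVec {α : Type*} [Fintype α] (p : α → ℝ) : Prop :=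
  (∀ a, 0 ≤ p a) ∧ ∑ a, p a = 1

/-- The intermediate belief at `θ` of a self-aware agent with current belief `μ`, likelihood
`L ζ θ = L(ζ|θ)`, self-awareness weight `g` and observed signal `ζ`. -/
noncomputable def intermediateBelief {Θ Z : Type*} [Fintype Θ]
    (L : Z → Θ → ℝ) (g : ℝ) (μ : Θ → ℝ) (ζ : Z) (θ : Θ) : ℝ :=
  (1 - g) * μ θ + g * (μ θ * L ζ θ / ∑ θ', μ θ' * L ζ θ')

/-- The beliefs `belief A L γ μ₀ x i k θ` of agent `k` at time `i` under the self-aware diffusion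
model, where `x k i` is the signal that agent `k` observes at time `i ≥ 1`. -/
noncomputable def belief {ι Θ : Type*} [Fintype ι] [Fintype Θ] {Z : ι → Type*}
    (A : Matrix ι ι ℝ) (L : ∀ k, Z k → Θ → ℝ) (γ : ι → ℕ → ℝ) (μ₀ : ι → Θ → ℝ)
    (x : ∀ k, ℕ → Z k) : ℕ → ι → Θ → ℝ
  | 0 => μ₀
  | i + 1 => fun k θ =>
      ∑ l, A l k *
        intermediateBelief (L l) (γ l (i + 1)) (belief A L γ μ₀ x i l) (x l (i + 1)) θ

/-- The true state of each agent is that of its sub-network. -/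
def trueState {S R : ℕ} {NS : Fin S → ℕ} {NR : Fin R → ℕ} {Θ : Type*}
    (θS : Fin S → Θ) (θR : Fin R → Θ) : Agent NS NR → Θ
  | Sum.inl k => θS k.1
  | Sum.inr k => θR k.1

/-- The observational signals: at each time `i ≥ 1` agent `k` observes `ξ k i`, distributed
according to `L_k(·|θ° k)`, and the signals (of all agents jointly) are independent over time.
The dependence between signals that different agents observe at the same time is arbitrary. -/
structure IsSignalProcess {ι Θ Ω : Type*} {Z : ι → Type*} [MeasurableSpace Ω]
    [∀ k, MeasurableSpace (Z k)] (P : Measure Ω) (L : ∀ k, Z k → Θ → ℝ) (θtrue : ι → Θ)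
    (ξ : ∀ k, ℕ → Ω → Z k) : Prop where
  measurable : ∀ k i, 1 ≤ i → Measurable (ξ k i)
  law : ∀ k i, 1 ≤ i → ∀ ζ : Z k, P.real {ω | ξ k i ω = ζ} = L k ζ (θtrue k)
  indep : iIndepFun (fun (i : ℕ) (ω : Ω) (k : ι) => ξ k (i + 1) ω) P

/-- The set of states that an agent with likelihood `L` cannot distinguish from `θ₀`. -/
def indistinguishable {Θ Z : Type*} (L : Z → Θ → ℝ) (θ₀ : Θ) : Set Θ :=
  {θ | ∀ ζ, L ζ θ = L ζ θ₀}

/-- The standing conditions on the sending sub-networks (truth learning conditions). -/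
structure SendingConditions {S R : ℕ} {NS : Fin S → ℕ} {NR : Fin R → ℕ} {Θ : Type*}
    {Z : Agent NS NR → Type*} (L : ∀ k, Z k → Θ → ℝ) (θS : Fin S → Θ)
    (γ : Agent NS NR → ℕ → ℝ) (μ₀ : Agent NS NR → Θ → ℝ) : Prop where
  /-- some agent of each sub-network has a positive prior belief about the true state -/
  prior_pos : ∀ s : Fin S, ∃ n : Fin (NS s), 0 < μ₀ (Sum.inl ⟨s, n⟩) (θS s)
  /-- global identifiability in each sub-network -/
  identifiable : ∀ s : Fin S,
    ⋂ n : Fin (NS s), indistinguishable (L (Sum.inl ⟨s, n⟩)) (θS s) = {θS s}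
  /-- each agent has a prevailing signal -/
  prevailing : ∀ k : SAgent NS, ∃ ζ : Z (Sum.inl k),
    ∀ θ, θ ∉ indistinguishable (L (Sum.inl k)) (θS k.1) →
      L (Sum.inl k) ζ θ < L (Sum.inl k) ζ (θS k.1)
  /-- the self-awareness weights stay away from zero in the long run -/
  weight_pos : ∀ k : SAgent NS, ∃ c : ℝ, 0 < c ∧ ∀ᶠ i in atTop, c ≤ γ (Sum.inl k) i

/-- The vectors `u i` (indexed by the receiving agents) are asymptotically confined between
`Wᵀ v - g C 1` and `Wᵀ v + g C 1`, elementwise. -/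
def IsConfined {S R : ℕ} {NS : Fin S → ℕ} {NR : Fin R → ℕ}
    (A : Matrix (Agent NS NR) (Agent NS NR) ℝ) (g : ℝ) (v : SAgent NS → ℝ)
    (u : ℕ → RAgent NR → ℝ) : Prop :=
  ∀ k : RAgent NR,
    limsup (fun i => u i k) atTop ≤ ((matrixW A)ᵀ *ᵥ v + g • (matrixC A *ᵥ 1)) k ∧
    ((matrixW A)ᵀ *ᵥ v - g • (matrixC A *ᵥ 1)) k ≤ liminf (fun i => u i k) atTop

/-! Receiving agents. A self-aware step moves a belief by at most its weight and each column of `A`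
has mass one, so the receiving beliefs `u` satisfy `u (i+1) = T_RRᵀ u i + T_SRᵀ v` up to an error
that is asymptotically at most `γmax` in each entry. No spectral radius is needed: by the minimum
principle `nonneg_of_superharmonic`, `T_RRᵀ x ≤ x` implies `0 ≤ x`. It makes `1 - T_RRᵀ` injective.
Since the entrywise limsup `U` satisfies `U ≤ T_RRᵀ U + w`, it also applies to `C w - U` and gives
`U ≤ C w`. The lower bound is the upper bound for `-u`.

Sending agents. Each sub-network evolves autonomously with a left-stochastic block `T`, which has a
positive invariant vector `y`. The potential `∑ y_k log μ_k(θ°)` is at most zero. Concavity of the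
logarithm, used in the self-aware step and again in the combination step (`potential_step`), shows
that its expectation grows at least by the weighted expected Kullback-Leibler divergences of the
forecasts from the true signal laws. These dominate squared Hellinger distances (`hellinger_le_kl`),
whose expectations are therefore summable, so almost surely every forecast becomes correct. A
prevailing signal then removes the states that its agent can distinguish from the truth, and this
removal travels backwards along the arcs to all agents (`tendsto_belief_of_forecasts`). By
identifiability only the true state survives. -/

/-! ### Minimum principle for the receiving agents, and confinement. -/

/-- If a nonnegative combination of the values of `x`, with weights of mass at most one, does not
exceed a negative minimum `x k`, then all the mass lies on minimizers. -/
theorem weights_on_minimizers {ι : Type*} [Fintype ι] {b : ι → ℝ} (hb : ∀ l, 0 ≤ b l)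
    (hs : ∑ l, b l ≤ 1) {x : ι → ℝ} {k : ι} (hmin : ∀ l, x k ≤ x l) (hneg : x k < 0)
    (hx : ∑ l, b l * x l ≤ x k) :
    ∑ l, b l = 1 ∧ ∀ l, 0 < b l → x l = x k := by
  have h1 : 0 ≤ ∑ l, b l * (x l - x k) :=
    Finset.sum_nonneg fun l _ => mul_nonneg (hb l) (sub_nonneg.2 (hmin l))
  have h2 : ∑ l, b l * (x l - x k) = ∑ l, b l * x l - (∑ l, b l) * x k := by
    simp [mul_sub, Finset.sum_sub_distrib, Finset.sum_mul]
  have h3 : ∑ l, b l = 1 := by nlinarith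
  refine ⟨h3, fun l hl => ?_⟩
  have h4 : ∑ l, b l * (x l - x k) = 0 := by
    rw [h3] at h2; linarith
  have h5 := (Finset.sum_eq_zero_iff_of_nonneg
    (fun l _ => mul_nonneg (hb l) (sub_nonneg.2 (hmin l)))).1 h4 l (Finset.mem_univ l)
  rcases mul_eq_zero.1 h5 with h | h
  · exact absurd h hl.ne'
  · linarith

namespace IsWeakNetwork

variable {S R : ℕ} {NS : Fin S → ℕ} {NR : Fin R → ℕ} {A : Matrix (Agent NS NR) (Agent NS NR) ℝ}

theorem sum_recv_le_one (hA : IsWeakNetwork A) (k : Agent NS NR) :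
    ∑ l : RAgent NR, A (Sum.inr l) k ≤ 1 := by
  have h := hA.col_sum k
  rw [Fintype.sum_sum_type] at h
  have : 0 ≤ ∑ l : SAgent NS, A (Sum.inl l) k := Finset.sum_nonneg fun l _ => hA.nonneg _ _
  linarith

/-- Minimum principle: a vector that is superharmonic for the receiving agents is nonnegative. -/
theorem nonneg_of_superharmonic (hA : IsWeakNetwork A) {x : RAgent NR → ℝ}
    (hx : ∀ k, ∑ l, A (Sum.inr l) (Sum.inr k) * x l ≤ x k) (k : RAgent NR) : 0 ≤ x k := by
  classical
  by_contra! hk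
  obtain ⟨k₀, -, hk₀⟩ := Finset.exists_min_image Finset.univ x ⟨k, Finset.mem_univ k⟩
  have hneg : x k₀ < 0 := lt_of_le_of_lt (hk₀ k (Finset.mem_univ k)) hk
  have key : ∀ q, x q = x k₀ → (∑ l : RAgent NR, A (Sum.inr l) (Sum.inr q) = 1 ∧
      ∀ l : RAgent NR, 0 < A (Sum.inr l) (Sum.inr q) → x l = x k₀) := by
    intro q hq
    have := weights_on_minimizers (b := fun l : RAgent NR => A (Sum.inr l) (Sum.inr q))
      (fun l => hA.nonneg _ _) (hA.sum_recv_le_one _) (x := x) (k := q)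
      (fun l => hq ▸ hk₀ l (Finset.mem_univ l)) (hq ▸ hneg) (hx q)
    rwa [hq] at this
  -- Take the minimizer in the receiving block of least index. Minimality fills its block along
  -- paths, and then an arc from outside is impossible: a sending source contradicts the mass one in
  -- `key`, a receiving one is a minimizer, excluded by the least index or by triangularity.
  obtain ⟨q, hq, hqmin⟩ := Finset.exists_min_image
    (Finset.univ.filter fun q : RAgent NR => x q = x k₀) (fun q => q.1) ⟨k₀, by simp⟩
  simp only [Finset.mem_filter, Finset.mem_univ, true_and] at hq hqmin
  obtain ⟨r, n⟩ := q
  have hblock : ∀ m : Fin (NR r), x ⟨r, m⟩ = x k₀ := by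
    intro m
    have hp := hA.recv_connected r m n
    induction hp using Relation.ReflTransGen.head_induction_on with
    | refl => exact hq
    | head hab _ ih => exact (key _ ih).2 _ hab
  obtain ⟨m, l, hl, hpos⟩ := hA.recv_fed r
  rcases l with l | l
  · have h := hA.col_sum (Sum.inr ⟨r, m⟩)
    rw [Fintype.sum_sum_type, (key _ (hblock m)).1] at h
    have h' : A (Sum.inl l) (Sum.inr ⟨r, m⟩) ≤ ∑ l : SAgent NS, A (Sum.inl l) (Sum.inr ⟨r, m⟩) :=
      Finset.single_le_sum (f := fun l : SAgent NS => A (Sum.inl l) (Sum.inr ⟨r, m⟩))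
        (fun l _ => hA.nonneg _ _) (Finset.mem_univ l)
    linarith
  · have hle := hqmin l ((key _ (hblock m)).2 l hpos)
    rcases lt_or_eq_of_le hle with hlt | heq
    · have := hA.recv_triangular l ⟨r, m⟩ hlt
      linarith
    · obtain ⟨r', m'⟩ := l
      change r = r' at heq
      subst heq
      exact hl m' rfl

theorem isUnit_one_sub_transpose (hA : IsWeakNetwork A) : IsUnit (1 - (blockRR A)ᵀ) := by
  rw [← Matrix.mulVec_injective_iff_isUnit]
  have hz : ∀ x, (1 - (blockRR A)ᵀ) *ᵥ x = 0 → ∀ k, 0 ≤ x k := by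
    intro x hx
    refine hA.nonneg_of_superharmonic fun k => ?_
    have := congrFun hx k
    simp only [Matrix.sub_mulVec, Matrix.one_mulVec, Pi.sub_apply, Pi.zero_apply] at this
    exact (sub_eq_zero.1 this).ge
  intro x y hxy
  have h1 : (1 - (blockRR A)ᵀ) *ᵥ (x - y) = 0 := by
    rw [Matrix.mulVec_sub]; exact sub_eq_zero.2 hxy
  have h2 : (1 - (blockRR A)ᵀ) *ᵥ (y - x) = 0 := by
    rw [Matrix.mulVec_sub]; exact sub_eq_zero.2 hxy.symm
  ext k
  have h3 := hz _ h1 k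
  have h4 := hz _ h2 k
  simp only [Pi.sub_apply] at h3 h4
  linarith

theorem isUnit_one_sub (hA : IsWeakNetwork A) : IsUnit (1 - blockRR A) := by
  have := hA.isUnit_one_sub_transpose
  rw [← Matrix.isUnit_transpose]
  simpa using this

/-- This fixed-point form is what can be compared with superharmonic vectors; the entries of the
inverse are never needed. -/
theorem matrixC_mulVec_eq (hA : IsWeakNetwork A) (w : RAgent NR → ℝ) (k : RAgent NR) :
    (matrixC A *ᵥ w) k
      = ∑ l, A (Sum.inr l) (Sum.inr k) * (matrixC A *ᵥ w) l + w k := by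
  have h : (1 - (blockRR A)ᵀ) *ᵥ (matrixC A *ᵥ w) = w := by
    rw [Matrix.mulVec_mulVec, matrixC,
      Matrix.mul_nonsing_inv _ ((Matrix.isUnit_iff_isUnit_det _).1 hA.isUnit_one_sub_transpose),
      Matrix.one_mulVec]
  have := congrFun h k
  simp only [Matrix.sub_mulVec, Matrix.one_mulVec, Pi.sub_apply] at this
  have h2 : ((blockRR A)ᵀ *ᵥ (matrixC A *ᵥ w)) k
    = ∑ l, A (Sum.inr l) (Sum.inr k) * (matrixC A *ᵥ w) l := rfl
  linarith

theorem matrixW_transpose_mulVec (v : SAgent NS → ℝ) :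
    (matrixW A)ᵀ *ᵥ v = matrixC A *ᵥ ((blockSR A)ᵀ *ᵥ v) := by
  rw [Matrix.mulVec_mulVec, matrixW, matrixC, Matrix.transpose_mul,
    Matrix.transpose_nonsing_inv, Matrix.transpose_sub, Matrix.transpose_one]

/-- An asymptotic affine recursive upper bound passes to the solution of the affine equation. -/
theorem eventually_le_of_recursion (hA : IsWeakNetwork A) {u : ℕ → RAgent NR → ℝ} {b : ℝ}
    (hu : ∀ i k, |u i k| ≤ b) {w : RAgent NR → ℝ}
    (hrec : ∀ k, ∀ ε > 0, ∀ᶠ i in atTop,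
      u (i + 1) k ≤ ∑ l, A (Sum.inr l) (Sum.inr k) * u i l + w k + ε)
    (k : RAgent NR) {ε : ℝ} (hε : 0 < ε) :
    ∀ᶠ i in atTop, u i k ≤ (matrixC A *ᵥ w) k + ε := by
  have hbd : ∀ k, IsBoundedUnder (· ≤ ·) atTop fun i => u i k := fun k =>
    isBoundedUnder_of ⟨b, fun i => (abs_le.1 (hu i k)).2⟩
  have hcb : ∀ k, IsCoboundedUnder (· ≤ ·) atTop fun i => u i k := fun k =>
    (isBoundedUnder_of ⟨-b, fun i => (abs_le.1 (hu i k)).1⟩ :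
      IsBoundedUnder (· ≥ ·) atTop fun i => u i k).isCoboundedUnder_le
  set U : RAgent NR → ℝ := fun k => limsup (fun i => u i k) atTop with hU
  have hlt : ∀ k, ∀ ε > 0, ∀ᶠ i in atTop, u i k ≤ U k + ε := fun k ε hε =>
    (eventually_lt_of_limsup_lt (lt_add_of_pos_right (U k) hε) (hbd k)).mono fun _ h => h.le
  -- The recursion survives passage to the limsup because the weights are nonnegative; their mass at
  -- most one keeps the total slack at `ε`.
  have hUrec : ∀ k, U k ≤ ∑ l, A (Sum.inr l) (Sum.inr k) * U l + w k := by
    intro k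
    refine le_of_forall_pos_le_add fun ε hε => ?_
    have h1 : ∀ᶠ i in atTop, ∀ l, u i l ≤ U l + ε / 2 :=
      eventually_all.2 fun l => hlt l _ (half_pos hε)
    have h2 : ∀ᶠ i in atTop,
        u (i + 1) k ≤ ∑ l, A (Sum.inr l) (Sum.inr k) * U l + w k + ε := by
      filter_upwards [h1, hrec k _ (half_pos hε)] with i hi hi'
      have h3 : ∑ l, A (Sum.inr l) (Sum.inr k) * u i l
          ≤ ∑ l, A (Sum.inr l) (Sum.inr k) * U l + ε / 2 := by
        calc _ ≤ ∑ l, A (Sum.inr l) (Sum.inr k) * (U l + ε / 2) :=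
              Finset.sum_le_sum fun l _ => mul_le_mul_of_nonneg_left (hi l) (hA.nonneg _ _)
          _ = ∑ l, A (Sum.inr l) (Sum.inr k) * U l
              + (∑ l : RAgent NR, A (Sum.inr l) (Sum.inr k)) * (ε / 2) := by
              simp [mul_add, Finset.sum_add_distrib, Finset.sum_mul]
          _ ≤ _ := by nlinarith [hA.sum_recv_le_one (Sum.inr k)]
      linarith
    refine limsup_le_of_le (hcb k) ?_
    obtain ⟨N, hN⟩ := eventually_atTop.1 h2
    filter_upwards [eventually_ge_atTop (N + 1)] with i hi
    obtain ⟨j, rfl⟩ : ∃ j, i = j + 1 := ⟨i - 1, by omega⟩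
    exact hN j (by omega)
  have hle : 0 ≤ (matrixC A *ᵥ w - U) k := by
    refine hA.nonneg_of_superharmonic (fun k => ?_) k
    have h1 := hA.matrixC_mulVec_eq w k
    have h2 := hUrec k
    simp only [Pi.sub_apply, mul_sub, Finset.sum_sub_distrib]
    linarith
  filter_upwards [hlt k ε hε] with i hi
  simp only [Pi.sub_apply] at hle
  linarith

/-- Confinement of sequences that follow a perturbed diffusion recursion driven by the sending
agents. -/
theorem isConfined_of_recursion (hA : IsWeakNetwork A) {μ ψ : ℕ → Agent NS NR → ℝ} {g : ℝ}
    (hbd : ∀ i k, |μ i k| ≤ 1) (hrec : ∀ i k, μ (i + 1) k = ∑ l, A l k * ψ i l)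
    (v : SAgent NS → ℝ)
    (hS : ∀ l, ∀ ε > 0, ∀ᶠ i in atTop, |ψ i (Sum.inl l) - v l| ≤ g + ε)
    (hR : ∀ i l, |ψ i (Sum.inr l) - μ i (Sum.inr l)| ≤ g) :
    IsConfined A g v (fun i k => μ i (Sum.inr k)) := by
  have hrec' : ∀ k, ∀ ε > 0, ∀ᶠ i in atTop,
      |μ (i + 1) (Sum.inr k) - ∑ l, A (Sum.inr l) (Sum.inr k) * μ i (Sum.inr l)
        - ((blockSR A)ᵀ *ᵥ v) k| ≤ g + ε := by
    intro k ε hε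
    filter_upwards [eventually_all.2 fun l => hS l ε hε] with i hi
    -- Each `ψ i l` is compared with the limit `v l` if `l` sends and with the agent's own previous
    -- belief if `l` receives.
    have h1 : μ (i + 1) (Sum.inr k) - ∑ l, A (Sum.inr l) (Sum.inr k) * μ i (Sum.inr l)
        - ((blockSR A)ᵀ *ᵥ v) k = ∑ l, A l (Sum.inr k) *
          (ψ i l - Sum.elim v (fun l => μ i (Sum.inr l)) l) := by
      have h2 : ((blockSR A)ᵀ *ᵥ v) k = ∑ l, A (Sum.inl l) (Sum.inr k) * v l := rfl
      rw [h2, hrec]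
      simp only [mul_sub, Finset.sum_sub_distrib, Fintype.sum_sum_type, Sum.elim_inl,
        Sum.elim_inr]
      ring
    rw [h1]
    calc _ ≤ ∑ l, |A l (Sum.inr k) * (ψ i l - Sum.elim v (fun l => μ i (Sum.inr l)) l)| :=
          Finset.abs_sum_le_sum_abs _ _
      _ ≤ ∑ l, A l (Sum.inr k) * (g + ε) := by
          refine Finset.sum_le_sum fun l _ => ?_
          rw [abs_mul, abs_of_nonneg (hA.nonneg _ _)]
          refine mul_le_mul_of_nonneg_left ?_ (hA.nonneg _ _)
          rcases l with l | l
          · exact hi l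
          · exact (hR i l).trans (by linarith)
      _ = g + ε := by rw [← Finset.sum_mul, hA.col_sum, one_mul]
  have hle : ∀ i (k : RAgent NR), μ i (Sum.inr k) ≤ 1 := fun i k => (abs_le.1 (hbd i _)).2
  have hge : ∀ i (k : RAgent NR), -1 ≤ μ i (Sum.inr k) := fun i k => (abs_le.1 (hbd i _)).1
  have hadd : ∀ k, ((matrixW A)ᵀ *ᵥ v + g • (matrixC A *ᵥ 1)) k
      = (matrixC A *ᵥ ((blockSR A)ᵀ *ᵥ v + g • 1)) k := fun k => by
    rw [matrixW_transpose_mulVec, Matrix.mulVec_add, Matrix.mulVec_smul]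
  -- The lower bound is written as minus the upper bound that belongs to the negated beliefs.
  have hsub : ∀ k, ((matrixW A)ᵀ *ᵥ v - g • (matrixC A *ᵥ 1)) k
      = -(matrixC A *ᵥ (g • 1 - (blockSR A)ᵀ *ᵥ v)) k := fun k => by
    rw [matrixW_transpose_mulVec, Matrix.mulVec_sub, Matrix.mulVec_smul]
    simp
  intro k
  constructor
  · rw [hadd]
    refine le_of_forall_pos_le_add fun ε hε => ?_
    refine limsup_le_of_le (isBoundedUnder_of ⟨-1, fun i => hge i k⟩ :
      IsBoundedUnder (· ≥ ·) atTop _).isCoboundedUnder_le ?_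
    refine hA.eventually_le_of_recursion (u := fun i k => μ i (Sum.inr k))
      (fun i k => hbd i _) (fun k ε hε => ?_) k hε
    filter_upwards [hrec' k ε hε] with i hi
    have := (abs_le.1 hi).2
    simp only [Pi.add_apply, Pi.smul_apply, Pi.one_apply, smul_eq_mul, mul_one]
    linarith
  · rw [hsub]
    refine le_of_forall_pos_le_add fun ε hε => ?_
    rw [← sub_le_iff_le_add]
    refine le_liminf_of_le (isBoundedUnder_of ⟨1, fun i => hle i k⟩ :
      IsBoundedUnder (· ≤ ·) atTop _).isCoboundedUnder_ge ?_
    have := hA.eventually_le_of_recursion (u := fun i k => -μ i (Sum.inr k))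
      (w := g • 1 - (blockSR A)ᵀ *ᵥ v) (b := 1)
      (fun i k => by rw [abs_neg]; exact hbd i _) (fun k ε hε => ?_) k hε
    · filter_upwards [this] with i hi
      linarith
    · filter_upwards [hrec' k ε hε] with i hi
      have := (abs_le.1 hi).1
      simp only [Pi.sub_apply, Pi.smul_apply, Pi.one_apply, smul_eq_mul, mul_one, mul_neg,
        Finset.sum_neg_distrib]
      linarith

end IsWeakNetwork

/-! ### Strongly connected networks: invariant vector and spreading of positivity. -/

/-- A strongly connected left-stochastic matrix has a positive invariant vector. -/
theorem exists_pos_invariant {ι : Type*} [Fintype ι] [Nonempty ι] {T : Matrix ι ι ℝ}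
    (h0 : ∀ l k, 0 ≤ T l k) (h1 : ∀ k, ∑ l, T l k = 1) (hc : IsPathConnectedNet T) :
    ∃ y : ι → ℝ, (∀ k, 0 < y k) ∧ ∀ l, ∑ k, T l k * y k = y l := by
  classical
  -- Unit column sums make the all-ones vector a left null vector, so a right null vector `z` exists
  -- as well.
  have hdet : (T - 1).det = 0 := by
    rw [← Matrix.exists_vecMul_eq_zero_iff]
    refine ⟨1, one_ne_zero, ?_⟩
    ext k
    rw [Matrix.vecMul_sub, Matrix.vecMul_one]
    simp [Matrix.vecMul, dotProduct, h1]
  obtain ⟨z, hz, hTz⟩ := Matrix.exists_mulVec_eq_zero_iff.2 hdet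
  have hTz' : ∀ l, ∑ k, T l k * z k = z l := by
    intro l
    have := congrFun hTz l
    simp only [Matrix.sub_mulVec, Matrix.one_mulVec, Pi.sub_apply, Pi.zero_apply] at this
    exact sub_eq_zero.1 this
  have hle : ∀ l, |z l| ≤ ∑ k, T l k * |z k| := by
    intro l
    rw [← hTz' l]
    refine (Finset.abs_sum_le_sum_abs _ _).trans (Finset.sum_le_sum fun k _ => ?_)
    rw [abs_mul, abs_of_nonneg (h0 _ _)]
  have hsum : ∑ l, ∑ k, T l k * |z k| = ∑ l, |z l| := by
    rw [Finset.sum_comm]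
    simp [← Finset.sum_mul, h1]
  -- The triangle inequalities `hle` have equal totals on both sides, so each is an equality and
  -- `|z|` is itself invariant.
  have heq : ∀ l, ∑ k, T l k * |z k| = |z l| := fun l =>
    (((Finset.sum_eq_sum_iff_of_le fun l _ => hle l).1 hsum.symm) l (Finset.mem_univ l)).symm
  obtain ⟨q, hq⟩ := Function.ne_iff.1 hz
  refine ⟨fun l => |z l|, fun l => ?_, heq⟩
  have hp := hc l q
  induction hp using Relation.ReflTransGen.head_induction_on with
  | refl => exact abs_pos.2 hq
  | @head a b hab _ ih =>
    change 0 < |z a|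
    rw [← heq]
    exact lt_of_lt_of_le (mul_pos hab ih) (Finset.single_le_sum (f := fun k => T a k * |z k|)
      (fun k _ => mul_nonneg (h0 _ _) (abs_nonneg _)) (Finset.mem_univ b))

/-- A property that spreads along the arcs of a strongly connected network and holds somewhere at
time zero eventually holds everywhere. -/
theorem IsStronglyConnectedNet.eventually_forall {ι : Type*} [Finite ι] {T : Matrix ι ι ℝ}
    (hc : IsStronglyConnectedNet T) {p : ℕ → ι → Prop}
    (hp : ∀ i l k, p i l → 0 < T l k → p (i + 1) k) {n : ι} (hn : p 0 n) :
    ∀ᶠ i in atTop, ∀ k, p i k := by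
  obtain ⟨hpath, q, hq⟩ := hc
  obtain ⟨a, ha⟩ : ∃ a, p a q := by
    have h := hpath n q
    clear hq
    induction h with
    | refl => exact ⟨0, hn⟩
    | tail _ hbc ih =>
      obtain ⟨i, hi⟩ := ih
      exact ⟨i + 1, hp i _ _ hi hbc⟩
  -- The self-loop at `q` keeps the property there forever; without it the property could alternate
  -- along cycles.
  have hqa : ∀ᶠ i in atTop, p i q := by
    filter_upwards [eventually_ge_atTop a] with i hi
    induction i, hi using Nat.le_induction with
    | base => exact ha
    | succ i _ ih => exact hp i q q ih hq
  refine eventually_all.2 fun k => ?_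
  have h := hpath q k
  induction h with
  | refl => exact hqa
  | tail _ hbc ih =>
    obtain ⟨N, hN⟩ := eventually_atTop.1 ih
    filter_upwards [eventually_ge_atTop (N + 1)] with i hi
    obtain ⟨j, rfl⟩ : ∃ j, i = j + 1 := ⟨i - 1, by omega⟩
    exact hp j _ _ (hN j (by omega)) hbc

/-! ### Forecasts, the self-aware step and the logarithmic potential. -/

/-- The Kullback-Leibler divergence from a sub-probability vector dominates the squared Hellinger
distance. -/
theorem hellinger_le_kl {Z : Type*} [Fintype Z] {p m : Z → ℝ} (hp : IsProbVec p)
    (hm : ∀ ζ, 0 ≤ m ζ) (hm1 : ∑ ζ, m ζ ≤ 1) (hpos : ∀ ζ, 0 < p ζ → 0 < m ζ) :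
    ∑ ζ, (√(p ζ) - √(m ζ)) ^ 2 ≤ ∑ ζ, p ζ * Real.log (p ζ / m ζ) := by
  have h : ∀ ζ, 2 * (p ζ - √(p ζ) * √(m ζ)) ≤ p ζ * Real.log (p ζ / m ζ) := by
    intro ζ
    rcases (hp.1 ζ).eq_or_lt with h0 | h0
    · simp [← h0]
    · have hs := Real.sqrt_pos.2 h0
      have ht := Real.sqrt_pos.2 (hpos ζ h0)
      -- The bound `log t ≤ t - 1` at `t = √(m/p)`.
      have h1 := Real.log_le_sub_one_of_pos (div_pos ht hs)
      have h2 : Real.log (p ζ / m ζ) = -2 * Real.log (√(m ζ) / √(p ζ)) := by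
        rw [Real.log_div h0.ne' (hpos ζ h0).ne', Real.log_div ht.ne' hs.ne',
          Real.log_sqrt (hm ζ), Real.log_sqrt (hp.1 ζ)]
        ring
      rw [h2]
      have h3 : √(p ζ) * √(m ζ) = p ζ * (√(m ζ) / √(p ζ)) := by
        field_simp
        exact Real.sq_sqrt h0.le
      rw [h3]
      nlinarith
  have h2 : ∀ ζ, (√(p ζ) - √(m ζ)) ^ 2 = 2 * (p ζ - √(p ζ) * √(m ζ)) - p ζ + m ζ := by
    intro ζ
    have h3 := Real.sq_sqrt (hp.1 ζ)
    have h4 := Real.sq_sqrt (hm ζ)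
    linear_combination h3 + h4
  calc _ = ∑ ζ, 2 * (p ζ - √(p ζ) * √(m ζ)) - ∑ ζ, p ζ + ∑ ζ, m ζ := by
        simp only [h2, Finset.sum_add_distrib, Finset.sum_sub_distrib]
    _ ≤ ∑ ζ, 2 * (p ζ - √(p ζ) * √(m ζ)) := by rw [hp.2]; linarith
    _ ≤ _ := Finset.sum_le_sum fun ζ _ => h ζ

/-- A nonnegative weight function on a finite type with total mass at most one. -/
def IsSubProbVec {α : Type*} [Fintype α] (p : α → ℝ) : Prop :=
  (∀ a, 0 ≤ p a) ∧ ∑ a, p a ≤ 1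

theorem IsProbVec.isSubProbVec {α : Type*} [Fintype α] {p : α → ℝ} (h : IsProbVec p) :
    IsSubProbVec p := ⟨h.1, h.2.le⟩

theorem IsSubProbVec.le_one {α : Type*} [Fintype α] {p : α → ℝ} (h : IsSubProbVec p) (a : α) :
    p a ≤ 1 :=
  (Finset.single_le_sum (f := p) (fun b _ => h.1 b) (Finset.mem_univ a)).trans h.2

/-- The probability that an agent with belief `μ` assigns to the signal `ζ`. -/
def predictive {Θ Z : Type*} [Fintype Θ] (L : Z → Θ → ℝ) (μ : Θ → ℝ) (ζ : Z) : ℝ :=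
  ∑ θ, μ θ * L ζ θ

section Local

variable {Θ Z : Type*} [Fintype Θ] {L : Z → Θ → ℝ} {μ : Θ → ℝ} {g : ℝ} {ζ : Z}

theorem intermediateBelief_eq (θ : Θ) : intermediateBelief L g μ ζ θ
    = (1 - g) * μ θ + g * (μ θ * L ζ θ / predictive L μ ζ) := rfl

theorem predictive_nonneg (hL : ∀ ζ θ, 0 ≤ L ζ θ) (hμ : ∀ θ, 0 ≤ μ θ) (ζ : Z) :
    0 ≤ predictive L μ ζ :=
  Finset.sum_nonneg fun θ _ => mul_nonneg (hμ θ) (hL ζ θ)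

theorem mul_le_predictive (hL : ∀ ζ θ, 0 ≤ L ζ θ) (hμ : ∀ θ, 0 ≤ μ θ) (ζ : Z) (θ : Θ) :
    μ θ * L ζ θ ≤ predictive L μ ζ :=
  Finset.single_le_sum (f := fun θ => μ θ * L ζ θ) (fun θ _ => mul_nonneg (hμ θ) (hL ζ θ))
    (Finset.mem_univ θ)

theorem sum_predictive [Fintype Z] (hL : ∀ θ, IsProbVec fun ζ => L ζ θ) :
    ∑ ζ, predictive L μ ζ = ∑ θ, μ θ := by
  unfold predictive
  rw [Finset.sum_comm]
  simp [← Finset.mul_sum, (hL _).2]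

/-- A zero denominator makes the whole posterior vanish, so mass can be lost. This is why beliefs
are tracked as sub-probability vectors. -/
theorem isSubProbVec_posterior (hL : ∀ ζ θ, 0 ≤ L ζ θ) (hμ : ∀ θ, 0 ≤ μ θ) (ζ : Z) :
    IsSubProbVec fun θ => μ θ * L ζ θ / predictive L μ ζ := by
  refine ⟨fun θ => div_nonneg (mul_nonneg (hμ θ) (hL ζ θ)) (predictive_nonneg hL hμ ζ), ?_⟩
  rw [← Finset.sum_div]
  exact div_self_le_one _

theorem isSubProbVec_intermediateBelief (hL : ∀ ζ θ, 0 ≤ L ζ θ) (hμ : IsSubProbVec μ)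
    (hg : g ∈ Set.Icc (0 : ℝ) 1) : IsSubProbVec (intermediateBelief L g μ ζ) := by
  have hp := isSubProbVec_posterior hL hμ.1 ζ
  refine ⟨fun θ => add_nonneg (mul_nonneg (sub_nonneg.2 hg.2) (hμ.1 θ))
    (mul_nonneg hg.1 (hp.1 θ)), ?_⟩
  simp only [intermediateBelief_eq, Finset.sum_add_distrib, ← Finset.mul_sum]
  nlinarith [hp.2, hμ.2, hg.1, hg.2]

theorem abs_intermediateBelief_sub_le (hL : ∀ ζ θ, 0 ≤ L ζ θ) (hμ : IsSubProbVec μ)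
    (hg : 0 ≤ g) (θ : Θ) : |intermediateBelief L g μ ζ θ - μ θ| ≤ g := by
  have hp := isSubProbVec_posterior hL hμ.1 ζ
  have h1 := hp.1 θ
  have h2 := hp.le_one θ
  have h3 := hμ.1 θ
  have h4 := hμ.le_one θ
  rw [intermediateBelief_eq]
  simp only at h1 h2
  rw [abs_le]
  constructor <;> nlinarith

/-- The log-belief moves at least as much as the weighted log-likelihood ratio. -/
theorem log_intermediateBelief_ge (hL : ∀ ζ θ, 0 ≤ L ζ θ) (hμ : ∀ θ, 0 ≤ μ θ)
    (hg : g ∈ Set.Icc (0 : ℝ) 1) {θ : Θ} (hpos : 0 < μ θ) (hLpos : 0 < L ζ θ) :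
    0 < intermediateBelief L g μ ζ θ ∧
    Real.log (μ θ) + g * Real.log (L ζ θ / predictive L μ ζ)
      ≤ Real.log (intermediateBelief L g μ ζ θ) := by
  have hm : 0 < predictive L μ ζ :=
    lt_of_lt_of_le (mul_pos hpos hLpos) (mul_le_predictive hL hμ ζ θ)
  have hr : 0 < μ θ * L ζ θ / predictive L μ ζ := div_pos (mul_pos hpos hLpos) hm
  have hcc := strictConcaveOn_log_Ioi.concaveOn
  have h := hcc.2 (Set.mem_Ioi.2 hpos) (Set.mem_Ioi.2 hr) (sub_nonneg.2 hg.2) hg.1 (by ring)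
  have h' := hcc.1 (Set.mem_Ioi.2 hpos) (Set.mem_Ioi.2 hr) (sub_nonneg.2 hg.2) hg.1 (by ring)
  simp only [smul_eq_mul] at h h'
  refine ⟨h', ?_⟩
  rw [intermediateBelief_eq]
  refine le_trans (le_of_eq ?_) h
  rw [mul_div_assoc, Real.log_mul hpos.ne' (div_pos hLpos hm).ne']
  ring

end Local

section Network

variable {ι Θ : Type*} [Fintype ι] [Fintype Θ] {Z : ι → Type*} {T : Matrix ι ι ℝ}
  {L : ∀ k, Z k → Θ → ℝ} {γ : ι → ℕ → ℝ} {μ₀ : ι → Θ → ℝ} {x : ∀ k, ℕ → Z k}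

theorem isSubProbVec_belief (h0 : ∀ l k, 0 ≤ T l k) (h1 : ∀ k, ∑ l, T l k = 1)
    (hL : ∀ k ζ θ, 0 ≤ L k ζ θ) (hγ : ∀ k i, γ k i ∈ Set.Icc (0 : ℝ) 1)
    (hμ₀ : ∀ k, IsProbVec (μ₀ k)) (i : ℕ) (k : ι) : IsSubProbVec (belief T L γ μ₀ x i k) := by
  induction i generalizing k with
  | zero => exact (hμ₀ k).isSubProbVec
  | succ i ih =>
    have h := fun l => isSubProbVec_intermediateBelief (ζ := x l (i + 1)) (hL l) (ih l)
      (hγ l (i + 1))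
    refine ⟨fun θ => Finset.sum_nonneg fun l _ => mul_nonneg (h0 _ _) ((h l).1 θ), ?_⟩
    simp only [belief]
    rw [Finset.sum_comm, ← h1 k]
    refine Finset.sum_le_sum fun l _ => ?_
    rw [← Finset.mul_sum]
    exact mul_le_of_le_one_right (h0 _ _) (h l).2

theorem belief_congr {x x' : ∀ k, ℕ → Z k} {i : ℕ}
    (h : ∀ j < i, ∀ k, x k (j + 1) = x' k (j + 1)) :
    belief T L γ μ₀ x i = belief T L γ μ₀ x' i := by
  induction i with
  | zero => rfl
  | succ i ih =>
    funext k θ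
    simp only [belief]
    rw [ih fun j hj => h j (hj.trans i.lt_succ_self)]
    simp only [h i i.lt_succ_self]

/-- Where the true state has positive likelihood, its beliefs become positive everywhere. -/
theorem eventually_belief_pos (h0 : ∀ l k, 0 ≤ T l k) (h1 : ∀ k, ∑ l, T l k = 1)
    (hc : IsStronglyConnectedNet T)
    (hL : ∀ k ζ θ, 0 ≤ L k ζ θ) (hγ : ∀ k i, γ k i ∈ Set.Icc (0 : ℝ) 1)
    (hμ₀ : ∀ k, IsProbVec (μ₀ k)) {θ : Θ} {n : ι} (hn : 0 < μ₀ n θ) :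
    ∃ N, ∀ x : ∀ k, ℕ → Z k, (∀ k i, 1 ≤ i → 0 < L k (x k i) θ) →
      ∀ i ≥ N, ∀ k, 0 < belief T L γ μ₀ x i k θ := by
  -- The signals are quantified inside the property, so that `N` does not depend on the realization.
  have := hc.eventually_forall (n := n) (p := fun i k =>
    ∀ x : ∀ k, ℕ → Z k, (∀ k i, 1 ≤ i → 0 < L k (x k i) θ) → 0 < belief T L γ μ₀ x i k θ)
    (fun i l k hp hT x hx => ?_) (fun x hx => hn)
  · obtain ⟨N, hN⟩ := eventually_atTop.1 this
    exact ⟨N, fun x hx i hi k => hN i hi k x hx⟩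
  · have hs := fun l => isSubProbVec_belief (x := x) h0 h1 hL hγ hμ₀ i l
    refine lt_of_lt_of_le (mul_pos hT (log_intermediateBelief_ge (hL l) (hs l).1
      (hγ l (i + 1)) (hp x hx) (hx l (i + 1) (by omega))).1) ?_
    exact Finset.single_le_sum (f := fun l => T l k * intermediateBelief (L l) (γ l (i + 1))
      (belief T L γ μ₀ x i l) (x l (i + 1)) θ) (fun l _ => mul_nonneg (h0 _ _)
      ((isSubProbVec_intermediateBelief (hL l) (hs l) (hγ l (i + 1))).1 θ)) (Finset.mem_univ l)

/-- The potential `∑ y_k log μ_k(θ)` increases at least by the weighted log-likelihood ratios. -/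
theorem potential_step (h0 : ∀ l k, 0 ≤ T l k) (h1 : ∀ k, ∑ l, T l k = 1)
    (hL : ∀ k ζ θ, 0 ≤ L k ζ θ) (hγ : ∀ k i, γ k i ∈ Set.Icc (0 : ℝ) 1)
    (hμ₀ : ∀ k, IsProbVec (μ₀ k)) {y : ι → ℝ} (hy : ∀ k, 0 < y k)
    (hTy : ∀ l, ∑ k, T l k * y k = y l) {θ : Θ} {i : ℕ}
    (hx : ∀ k, 0 < L k (x k (i + 1)) θ) (hpos : ∀ k, 0 < belief T L γ μ₀ x i k θ) :
    ∑ k, y k * Real.log (belief T L γ μ₀ x i k θ)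
      + ∑ k, y k * (γ k (i + 1) * Real.log (L k (x k (i + 1)) θ /
        predictive (L k) (belief T L γ μ₀ x i k) (x k (i + 1))))
      ≤ ∑ k, y k * Real.log (belief T L γ μ₀ x (i + 1) k θ) := by
  have hs := fun l => isSubProbVec_belief (x := x) h0 h1 hL hγ hμ₀ i l
  have hψ := fun l => log_intermediateBelief_ge (hL l) (hs l).1 (hγ l (i + 1)) (hpos l) (hx l)
  set ψ : ι → ℝ := fun l => intermediateBelief (L l) (γ l (i + 1))
    (belief T L γ μ₀ x i l) (x l (i + 1)) θ with hψdef
  have hjensen : ∀ k, ∑ l, T l k * Real.log (ψ l)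
      ≤ Real.log (belief T L γ μ₀ x (i + 1) k θ) := fun k => by
    have := strictConcaveOn_log_Ioi.concaveOn.le_map_sum (t := Finset.univ)
      (w := fun l => T l k) (p := ψ) (fun l _ => h0 l k) (h1 k) (fun l _ => (hψ l).1)
    simp only [smul_eq_mul] at this
    exact this
  calc _ = ∑ k, y k * (Real.log (belief T L γ μ₀ x i k θ)
        + γ k (i + 1) * Real.log (L k (x k (i + 1)) θ /
        predictive (L k) (belief T L γ μ₀ x i k) (x k (i + 1)))) := by
        simp only [mul_add, Finset.sum_add_distrib]
    _ ≤ ∑ l, y l * Real.log (ψ l) :=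
        Finset.sum_le_sum fun l _ => mul_le_mul_of_nonneg_left (hψ l).2 (hy l).le
    -- Invariance of `y` redistributes the weights so that Jensen's inequality applies to each
    -- column.
    _ = ∑ k, y k * ∑ l, T l k * Real.log (ψ l) := by
        simp only [Finset.mul_sum]
        rw [Finset.sum_comm]
        refine Finset.sum_congr rfl fun l _ => ?_
        rw [← hTy l, Finset.sum_mul]
        exact Finset.sum_congr rfl fun k _ => by ring
    _ ≤ _ := Finset.sum_le_sum fun k _ => mul_le_mul_of_nonneg_left (hjensen k) (hy k).le

end Network

/-! ### From correct forecasts to learning, for a fixed realization. -/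

theorem tendsto_of_hellinger {Z : Type*} [Fintype Z] {p : Z → ℝ} {m : ℕ → Z → ℝ}
    (hp : ∀ ζ, 0 ≤ p ζ) (hm : ∀ i ζ, 0 ≤ m i ζ)
    (h : Tendsto (fun i => ∑ ζ, (√(p ζ) - √(m i ζ)) ^ 2) atTop (𝓝 0)) (ζ : Z) :
    Tendsto (fun i => m i ζ) atTop (𝓝 (p ζ)) := by
  have h1 : Tendsto (fun i => (√(p ζ) - √(m i ζ)) ^ 2) atTop (𝓝 0) :=
    squeeze_zero (fun i => sq_nonneg _) (fun i => Finset.single_le_sum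
      (f := fun ζ => (√(p ζ) - √(m i ζ)) ^ 2) (fun _ _ => sq_nonneg _) (Finset.mem_univ ζ)) h
  have h2 : Tendsto (fun i => √(p ζ) - √(m i ζ)) atTop (𝓝 0) := by
    rw [tendsto_zero_iff_abs_tendsto_zero]
    have := h1.sqrt
    simpa [Real.sqrt_sq_eq_abs, Function.comp_def] using this
  have h3 : Tendsto (fun i => √(m i ζ)) atTop (𝓝 (√(p ζ))) := by
    have := (tendsto_const_nhds (x := √(p ζ))).sub h2
    simpa using this
  have h4 := h3.pow 2
  rw [Real.sq_sqrt (hp ζ)] at h4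
  exact h4.congr fun i => Real.sq_sqrt (hm i ζ)

/-- Convergence along every signal of positive likelihood gives convergence along the signals that
are observed. -/
theorem tendsto_along_signals {Z : Type*} [Finite Z] {p : Z → ℝ} {x : ℕ → Z}
    (hx : ∀ i, 0 < p (x (i + 1))) {f : ℕ → Z → ℝ}
    (hf : ∀ ζ, 0 < p ζ → Tendsto (fun i => f i ζ) atTop (𝓝 0)) :
    Tendsto (fun i => f i (x (i + 1))) atTop (𝓝 0) := by
  rw [Metric.tendsto_nhds]
  intro ε hε
  have : ∀ᶠ i in atTop, ∀ ζ, 0 < p ζ → dist (f i ζ) 0 < ε := by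
    refine eventually_all.2 fun ζ => ?_
    by_cases h : 0 < p ζ
    · filter_upwards [(Metric.tendsto_nhds.1 (hf ζ h)) ε hε] with i hi _ using hi
    · exact Eventually.of_forall fun i h' => absurd h' h
  filter_upwards [this] with i hi using hi _ (hx i)

section Agent

variable {Θ Z : Type*} [Fintype Θ] [Fintype Z] {L : Z → Θ → ℝ} {μ : ℕ → Θ → ℝ} {g : ℕ → ℝ}
  {θ₀ : Θ} {x : ℕ → Z}

theorem tendsto_sum_belief (hL : ∀ θ, IsProbVec fun ζ => L ζ θ)
    (hm : ∀ ζ, Tendsto (fun i => predictive L (μ i) ζ) atTop (𝓝 (L ζ θ₀))) :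
    Tendsto (fun i => ∑ θ, μ i θ) atTop (𝓝 1) := by
  rw [← (hL θ₀).2]
  exact (tendsto_finsetSum Finset.univ fun ζ _ => hm ζ).congr fun i => sum_predictive hL

/-- Correct forecasts of a prevailing signal exclude the distinguishable states. -/
theorem tendsto_zero_of_prevailing (hL : ∀ θ, IsProbVec fun ζ => L ζ θ) (hμ : ∀ i θ, 0 ≤ μ i θ)
    (hm : ∀ ζ, Tendsto (fun i => predictive L (μ i) ζ) atTop (𝓝 (L ζ θ₀))) {ζ : Z}
    (hζ : ∀ θ, θ ∉ indistinguishable L θ₀ → L ζ θ < L ζ θ₀)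
    {θ : Θ} (hθ : θ ∉ indistinguishable L θ₀) : Tendsto (fun i => μ i θ) atTop (𝓝 0) := by
  have hle : ∀ θ, L ζ θ ≤ L ζ θ₀ := fun θ => by
    by_cases h : θ ∈ indistinguishable L θ₀
    · exact (h ζ).le
    · exact (hζ θ h).le
  -- This difference is a sum of the nonnegative terms `μ i θ * (L ζ θ₀ - L ζ θ)`, so each of them
  -- tends to zero.
  have h1 : Tendsto (fun i => L ζ θ₀ * ∑ θ, μ i θ - predictive L (μ i) ζ) atTop (𝓝 0) := by
    have := ((tendsto_sum_belief hL hm).const_mul (L ζ θ₀)).sub (hm ζ)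
    simpa using this
  have h2 : Tendsto (fun i => μ i θ * (L ζ θ₀ - L ζ θ)) atTop (𝓝 0) := by
    refine squeeze_zero (fun i => mul_nonneg (hμ i θ) (sub_nonneg.2 (hle θ))) (fun i => ?_) h1
    have h3 : L ζ θ₀ * ∑ θ, μ i θ - predictive L (μ i) ζ
        = ∑ θ, μ i θ * (L ζ θ₀ - L ζ θ) := by
      simp only [predictive, Finset.mul_sum, mul_sub, Finset.sum_sub_distrib]
      simp only [mul_comm]
    rw [h3]
    exact Finset.single_le_sum (f := fun θ => μ i θ * (L ζ θ₀ - L ζ θ))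
      (fun θ _ => mul_nonneg (hμ i θ) (sub_nonneg.2 (hle θ))) (Finset.mem_univ θ)
  have h3 := h2.div_const (L ζ θ₀ - L ζ θ)
  rw [zero_div] at h3
  exact h3.congr fun i => mul_div_cancel_right₀ _ (sub_pos.2 (hζ θ hθ)).ne'

/-- For a state indistinguishable from `θ₀` the Bayes factor is the true likelihood over the
forecast, which tends to one along the observed signals. -/
theorem tendsto_intermediateBelief_sub (hμ : ∀ i, IsSubProbVec (μ i))
    (hg : ∀ i, g i ∈ Set.Icc (0 : ℝ) 1) (hx : ∀ i, 0 < L (x (i + 1)) θ₀)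
    (hm : ∀ ζ, Tendsto (fun i => predictive L (μ i) ζ) atTop (𝓝 (L ζ θ₀)))
    {θ : Θ} (hθ : θ ∈ indistinguishable L θ₀) :
    Tendsto (fun i => intermediateBelief L (g (i + 1)) (μ i) (x (i + 1)) θ - μ i θ)
      atTop (𝓝 0) := by
  have h := tendsto_along_signals (p := fun ζ => L ζ θ₀) hx (f := fun i ζ => L ζ θ₀ / predictive L (μ i) ζ - 1)
    fun ζ hζ => by
      have := ((tendsto_const_nhds (x := L ζ θ₀)).div (hm ζ) hζ.ne').sub_const 1
      simpa [div_self hζ.ne'] using this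
  refine squeeze_zero_norm (fun i => ?_) (norm_zero (E := ℝ) ▸ h.norm)
  have h1 : intermediateBelief L (g (i + 1)) (μ i) (x (i + 1)) θ - μ i θ
      = g (i + 1) * μ i θ * (L (x (i + 1)) θ₀ / predictive L (μ i) (x (i + 1)) - 1) := by
    rw [intermediateBelief_eq, hθ]
    ring
  rw [h1, norm_mul]
  refine mul_le_of_le_one_left (norm_nonneg _) ?_
  rw [Real.norm_of_nonneg (mul_nonneg (hg _).1 ((hμ i).1 θ))]
  exact mul_le_one₀ (hg _).2 ((hμ i).1 θ) ((hμ i).le_one θ)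

theorem tendsto_intermediateBelief_zero
    (hg : ∀ i, g i ∈ Set.Icc (0 : ℝ) 1) (hx : ∀ i, 0 < L (x (i + 1)) θ₀)
    (hm : ∀ ζ, Tendsto (fun i => predictive L (μ i) ζ) atTop (𝓝 (L ζ θ₀)))
    {θ : Θ} (hθ : Tendsto (fun i => μ i θ) atTop (𝓝 0)) :
    Tendsto (fun i => intermediateBelief L (g (i + 1)) (μ i) (x (i + 1)) θ) atTop (𝓝 0) := by
  have h := tendsto_along_signals (p := fun ζ => L ζ θ₀) hx (f := fun i ζ => μ i θ * L ζ θ / predictive L (μ i) ζ)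
    fun ζ hζ => by
      have := (hθ.mul_const (L ζ θ)).div (hm ζ) hζ.ne'
      simpa [Pi.div_def] using this
  have h2 := hθ.norm.add h.norm
  rw [norm_zero, add_zero] at h2
  refine squeeze_zero_norm (fun i => ?_) h2
  rw [intermediateBelief_eq]
  refine (norm_add_le _ _).trans (add_le_add ?_ ?_)
  · rw [norm_mul]
    refine mul_le_of_le_one_left (norm_nonneg _) ?_
    rw [Real.norm_of_nonneg (sub_nonneg.2 (hg _).2)]
    linarith [(hg (i + 1)).1]
  · rw [norm_mul]
    refine mul_le_of_le_one_left (norm_nonneg _) ?_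
    rw [Real.norm_of_nonneg (hg _).1]
    exact (hg (i + 1)).2

end Agent

/-- Once all agents of a connected network make correct forecasts, they learn the truth. -/
theorem tendsto_belief_of_forecasts {ι Θ : Type*} [Fintype ι] [Fintype Θ] [DecidableEq Θ]
    {Z : ι → Type*} [∀ k, Fintype (Z k)] {T : Matrix ι ι ℝ}
    {L : ∀ k, Z k → Θ → ℝ} {γ : ι → ℕ → ℝ} {μ₀ : ι → Θ → ℝ} {x : ∀ k, ℕ → Z k}
    (h0 : ∀ l k, 0 ≤ T l k) (h1 : ∀ k, ∑ l, T l k = 1) (hc : IsPathConnectedNet T)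
    (hL : ∀ k θ, IsProbVec fun ζ => L k ζ θ) (hγ : ∀ k i, γ k i ∈ Set.Icc (0 : ℝ) 1)
    (hμ₀ : ∀ k, IsProbVec (μ₀ k)) {θ₀ : Θ}
    (hid : ⋂ k, indistinguishable (L k) θ₀ = {θ₀})
    (hprev : ∀ k, ∃ ζ, ∀ θ, θ ∉ indistinguishable (L k) θ₀ → L k ζ θ < L k ζ θ₀)
    (hx : ∀ k i, 0 < L k (x k (i + 1)) θ₀)
    (hm : ∀ k ζ, Tendsto (fun i => predictive (L k) (belief T L γ μ₀ x i k) ζ) atTop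
      (𝓝 (L k ζ θ₀))) (k : ι) (θ : Θ) :
    Tendsto (fun i => belief T L γ μ₀ x i k θ) atTop (𝓝 (if θ = θ₀ then 1 else 0)) ∧
    Tendsto (fun i => intermediateBelief (L k) (γ k (i + 1)) (belief T L γ μ₀ x i k)
      (x k (i + 1)) θ) atTop (𝓝 (if θ = θ₀ then 1 else 0)) := by
  have hL0 : ∀ k ζ θ, 0 ≤ L k ζ θ := fun k ζ θ => (hL k θ).1 ζ
  have hs := fun i l => isSubProbVec_belief (x := x) h0 h1 hL0 hγ hμ₀ i l
  have hsub := fun l θ => tendsto_intermediateBelief_sub (θ := θ) (g := γ l) (x := x l)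
    (fun i => hs i l) (hγ l) (hx l) (hm l)
  have hout : ∀ l θ, θ ∉ indistinguishable (L l) θ₀ →
      Tendsto (fun i => belief T L γ μ₀ x i l θ) atTop (𝓝 0) := fun l θ hθ => by
    obtain ⟨ζ, hζ⟩ := hprev l
    exact tendsto_zero_of_prevailing (hL l) (fun i => (hs i l).1) (hm l) hζ hθ
  -- A vanishing belief at `k` forces the intermediate belief of its neighbour `l` to vanish. If `l`
  -- cannot distinguish `θ`, its belief follows; otherwise `hout` applies.
  have hback : ∀ θ l k, 0 < T l k → Tendsto (fun i => belief T L γ μ₀ x i k θ) atTop (𝓝 0) →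
      Tendsto (fun i => belief T L γ μ₀ x i l θ) atTop (𝓝 0) := by
    intro θ l k hlk hk
    by_cases hθ : θ ∈ indistinguishable (L l) θ₀
    · have hψ : Tendsto (fun i => intermediateBelief (L l) (γ l (i + 1))
          (belief T L γ μ₀ x i l) (x l (i + 1)) θ) atTop (𝓝 0) := by
        have hψ0 : ∀ i l, 0 ≤ intermediateBelief (L l) (γ l (i + 1))
            (belief T L γ μ₀ x i l) (x l (i + 1)) θ := fun i l =>
          (isSubProbVec_intermediateBelief (hL0 l) (hs i l) (hγ l (i + 1))).1 θ
        have h2 := ((tendsto_add_atTop_iff_nat 1).2 hk).div_const (T l k)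
        rw [zero_div] at h2
        refine squeeze_zero (fun i => hψ0 i l) (fun i => ?_) h2
        rw [le_div_iff₀' hlk]
        exact Finset.single_le_sum (f := fun l => T l k * intermediateBelief (L l) (γ l (i + 1))
          (belief T L γ μ₀ x i l) (x l (i + 1)) θ) (fun l _ => mul_nonneg (h0 _ _) (hψ0 i l))
          (Finset.mem_univ l)
      have := hψ.sub (hsub l θ hθ)
      simpa using this
    · exact hout l θ hθ
  have hzero : ∀ θ, θ ≠ θ₀ → ∀ l, Tendsto (fun i => belief T L γ μ₀ x i l θ) atTop (𝓝 0) := by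
    intro θ hθ l
    obtain ⟨q, hq⟩ : ∃ q, θ ∉ indistinguishable (L q) θ₀ := by
      by_contra! h
      have : θ ∈ ⋂ k, indistinguishable (L k) θ₀ := Set.mem_iInter.2 h
      rw [hid] at this
      exact hθ this
    have hp := hc l q
    induction hp using Relation.ReflTransGen.head_induction_on with
    | refl => exact hout q θ hq
    | head hab _ ih => exact hback θ _ _ hab ih
  split_ifs with hθ
  · subst hθ
    have h2 : Tendsto (fun i => belief T L γ μ₀ x i k θ) atTop (𝓝 1) := by
      have h3 := (tendsto_sum_belief (hL k) (hm k)).sub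
        (tendsto_finsetSum (Finset.univ.erase θ)
          fun θ' hθ' => hzero θ' (Finset.ne_of_mem_erase hθ') k)
      rw [Finset.sum_const_zero, sub_zero] at h3
      refine h3.congr fun i => ?_
      rw [← Finset.add_sum_erase Finset.univ _ (Finset.mem_univ θ)]
      ring
    refine ⟨h2, ?_⟩
    have := (hsub k θ fun _ => rfl).add h2
    simpa using this
  · exact ⟨hzero θ hθ k, tendsto_intermediateBelief_zero (hγ k) (hx k) (hm k) (hzero θ hθ k)⟩

/-! ### Integration over finite signal histories. -/

/-- Nonnegative functions with summable integrals tend to zero almost everywhere. -/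
theorem ae_tendsto_zero_of_summable_integral {Ω : Type*} [MeasurableSpace Ω] {P : Measure Ω}
    {f : ℕ → Ω → ℝ} (hf : ∀ i, Integrable (f i) P) (h0 : ∀ i ω, 0 ≤ f i ω)
    (hs : Summable fun i => ∫ ω, f i ω ∂P) : ∀ᵐ ω ∂P, Tendsto (fun i => f i ω) atTop (𝓝 0) := by
  have hm : ∀ i, AEMeasurable (fun ω => ENNReal.ofReal (f i ω)) P := fun i =>
    (hf i).aestronglyMeasurable.aemeasurable.ennreal_ofReal
  have h1 : ∫⁻ ω, ∑' i, ENNReal.ofReal (f i ω) ∂P ≠ ⊤ := by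
    rw [lintegral_tsum hm]
    simp_rw [← ofReal_integral_eq_lintegral_ofReal (hf _) (Eventually.of_forall (h0 _))]
    exact hs.tsum_ofReal_ne_top
  filter_upwards [ae_lt_top' (AEMeasurable.tsum hm) h1] with ω hω
  have h2 := ENNReal.tendsto_atTop_zero_of_tsum_ne_top hω.ne
  have h3 := (ENNReal.tendsto_toReal ENNReal.zero_ne_top).comp h2
  simpa [Function.comp_def, ENNReal.toReal_ofReal (h0 _ _)] using h3

namespace IsSignalProcess

variable {ι Θ Ω : Type*} [Fintype ι] {Z : ι → Type*} [∀ k, Fintype (Z k)] [MeasurableSpace Ω]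
    [∀ k, MeasurableSpace (Z k)] [∀ k, MeasurableSingletonClass (Z k)]
    {P : Measure Ω} [IsProbabilityMeasure P]
    {L : ∀ k, Z k → Θ → ℝ} {θtrue : ι → Θ} {ξ : ∀ k, ℕ → Ω → Z k}

omit [Fintype ι] [∀ k, Fintype (Z k)] [∀ k, MeasurableSingletonClass (Z k)]
  [IsProbabilityMeasure P] in
theorem measurable_signals (hξ : IsSignalProcess P L θtrue ξ) (i : ℕ) :
    Measurable fun ω k => ξ k (i + 1) ω :=
  measurable_pi_lambda _ fun k => hξ.measurable k _ (by omega)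

omit [Fintype ι] [∀ k, Fintype (Z k)] [MeasurableSpace Ω] [∀ k, MeasurableSpace (Z k)]
  [∀ k, MeasurableSingletonClass (Z k)] in
/-- A function of the signals up to time `i` factors through the finite space of histories. -/
theorem exists_history_factor {i : ℕ} {F : Ω → ℝ}
    (hF : ∀ ω ω', (∀ j < i, ∀ k, ξ k (j + 1) ω = ξ k (j + 1) ω') → F ω = F ω') :
    ∃ G : (Finset.range i → ∀ k, Z k) → ℝ,
      F = G ∘ fun ω (j : Finset.range i) k => ξ k (j + 1) ω := by
  refine ⟨Function.extend (fun ω (j : Finset.range i) k => ξ k (j + 1) ω) F 0, ?_⟩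
  funext ω
  refine (Function.FactorsThrough.extend_apply (fun ω ω' h => hF ω ω' fun j hj k => ?_) _ _).symm
  exact congrFun (congrFun h ⟨j, Finset.mem_range.2 hj⟩) k

/-- The space of histories is finite, so any function of them is measurable and bounded. This covers
logarithms of beliefs that may vanish, as `Real.log 0 = 0`. -/
theorem integrable_of_history (hξ : IsSignalProcess P L θtrue ξ) {i : ℕ} {F : Ω → ℝ}
    (hF : ∀ ω ω', (∀ j < i, ∀ k, ξ k (j + 1) ω = ξ k (j + 1) ω') → F ω = F ω') :
    Integrable F P := by
  obtain ⟨G, rfl⟩ := exists_history_factor hF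
  have hH : Measurable fun ω (j : Finset.range i) k => ξ k (j + 1) ω :=
    measurable_pi_lambda _ fun j => hξ.measurable_signals j
  have : IsProbabilityMeasure (P.map fun ω (j : Finset.range i) k => ξ k (j + 1) ω) :=
    Measure.isProbabilityMeasure_map hH.aemeasurable
  exact Integrable.comp_measurable (Integrable.of_finite) hH

/-- The signal at time `i + 1` is independent of the history up to time `i`. -/
theorem integral_indicator_mul_history (hξ : IsSignalProcess P L θtrue ξ) {i : ℕ} {F : Ω → ℝ}
    (hF : ∀ ω ω', (∀ j < i, ∀ k, ξ k (j + 1) ω = ξ k (j + 1) ω') → F ω = F ω')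
    (l : ι) (ζ : Z l) :
    ∫ ω, {ω | ξ l (i + 1) ω = ζ}.indicator 1 ω * F ω ∂P = L l ζ (θtrue l) * ∫ ω, F ω ∂P := by
  have hint := hξ.integrable_of_history hF
  obtain ⟨G, rfl⟩ := exists_history_factor hF
  have hind := hξ.indep.indepFun_finset {i} (Finset.range i)
    (by simp) fun j => hξ.measurable_signals j
  have hmeas : MeasurableSet {ω | ξ l (i + 1) ω = ζ} :=
    hξ.measurable l (i + 1) (by omega) (measurableSet_singleton ζ)
  classical
  let D : (({i} : Finset ℕ) → ∀ k, Z k) → ℝ := fun h =>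
    if h ⟨i, Finset.mem_singleton_self i⟩ l = ζ then 1 else 0
  have hD : (D ∘ fun ω (j : ({i} : Finset ℕ)) k => ξ k (j + 1) ω)
      = {ω | ξ l (i + 1) ω = ζ}.indicator 1 := by
    funext ω
    simp [D, Set.indicator_apply]
  have hind2 := hind.comp (measurable_of_finite D) (measurable_of_finite G)
  rw [hD] at hind2
  rw [hind2.integral_fun_mul_eq_mul_integral
    ((measurable_one.indicator hmeas).aestronglyMeasurable) hint.aestronglyMeasurable,
    integral_indicator_one hmeas, hξ.law l (i + 1) (by omega) ζ]

omit [∀ k, MeasurableSingletonClass (Z k)] in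
theorem ae_likelihood_pos (hξ : IsSignalProcess P L θtrue ξ)
    (hL : ∀ k ζ, 0 ≤ L k ζ (θtrue k)) :
    ∀ᵐ ω ∂P, ∀ k i, 1 ≤ i → 0 < L k (ξ k i ω) (θtrue k) := by
  have h : ∀ k i, 1 ≤ i → ∀ ζ, L k ζ (θtrue k) = 0 → ∀ᵐ ω ∂P, ξ k i ω ≠ ζ := by
    intro k i hi ζ hζ
    have hlaw := hξ.law k i hi ζ
    rw [hζ, measureReal_eq_zero_iff] at hlaw
    simpa [ae_iff] using hlaw
  simp only [ae_all_iff]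
  intro k i hi
  have h2 : ∀ᵐ ω ∂P, ∀ ζ, L k ζ (θtrue k) = 0 → ξ k i ω ≠ ζ := by
    refine ae_all_iff.2 fun ζ => ?_
    by_cases hζ : L k ζ (θtrue k) = 0
    · exact (h k i hi ζ hζ).mono fun _ hω _ => hω
    · exact Eventually.of_forall fun _ h' => absurd h' hζ
  filter_upwards [h2] with ω hω
  exact lt_of_le_of_ne (hL k _) fun h' => hω _ h'.symm rfl

end IsSignalProcess

/-! ### Summable forecast errors and almost sure learning. -/

section Learning

variable {ι Θ Ω : Type*} [Fintype ι] [Fintype Θ] {Z : ι → Type*} [∀ k, Fintype (Z k)]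
  [MeasurableSpace Ω] [∀ k, MeasurableSpace (Z k)] [∀ k, MeasurableSingletonClass (Z k)]
  {P : Measure Ω} [IsProbabilityMeasure P] {T : Matrix ι ι ℝ}
  {L : ∀ k, Z k → Θ → ℝ} {γ : ι → ℕ → ℝ} {μ₀ : ι → Θ → ℝ} {ξ : ∀ k, ℕ → Ω → Z k} {θ₀ : Θ}

/-- The squared Hellinger distance between the true and the forecast distributions of the next
signal of agent `k`. -/
noncomputable def forecastError (L : ∀ k, Z k → Θ → ℝ) (θ₀ : Θ) (μ : ι → Θ → ℝ) (k : ι) : ℝ :=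
  ∑ ζ, (√(L k ζ θ₀) - √(predictive (L k) (μ k) ζ)) ^ 2

omit [Fintype ι] [∀ k, MeasurableSpace (Z k)] [∀ k, MeasurableSingletonClass (Z k)] in
theorem forecastError_nonneg (μ : ι → Θ → ℝ) (k : ι) : 0 ≤ forecastError L θ₀ μ k :=
  Finset.sum_nonneg fun _ _ => sq_nonneg _

omit [∀ k, Fintype (Z k)] [MeasurableSpace Ω] [∀ k, MeasurableSpace (Z k)]
  [∀ k, MeasurableSingletonClass (Z k)] in
theorem belief_history {i : ℕ} {ω ω' : Ω}
    (h : ∀ j < i, ∀ k, ξ k (j + 1) ω = ξ k (j + 1) ω') :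
    belief T L γ μ₀ (fun k i => ξ k i ω) i = belief T L γ μ₀ (fun k i => ξ k i ω') i :=
  belief_congr h

/-- The expected log-likelihood ratio dominates the expected forecast error. -/
theorem integral_forecastError_le (h0 : ∀ l k, 0 ≤ T l k) (h1 : ∀ k, ∑ l, T l k = 1)
    (hL : ∀ k θ, IsProbVec fun ζ => L k ζ θ) (hγ : ∀ k i, γ k i ∈ Set.Icc (0 : ℝ) 1)
    (hμ₀ : ∀ k, IsProbVec (μ₀ k)) (hξ : IsSignalProcess P L (fun _ => θ₀) ξ) {i : ℕ} {k : ι}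
    (hpos : ∀ᵐ ω ∂P, 0 < belief T L γ μ₀ (fun k i => ξ k i ω) i k θ₀) :
    ∫ ω, forecastError L θ₀ (belief T L γ μ₀ (fun k i => ξ k i ω) i) k ∂P ≤
    ∫ ω, Real.log (L k (ξ k (i + 1) ω) θ₀ /
        predictive (L k) (belief T L γ μ₀ (fun k i => ξ k i ω) i k) (ξ k (i + 1) ω)) ∂P := by
  classical
  have hL0 : ∀ k ζ θ, 0 ≤ L k ζ θ := fun k ζ θ => (hL k θ).1 ζ
  -- With the signal frozen at `ζ` the log-ratio depends on the history alone, so independence turns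
  -- the expectation into that of a Kullback-Leibler divergence.
  let F : Z k → Ω → ℝ := fun ζ ω => Real.log (L k ζ θ₀ /
    predictive (L k) (belief T L γ μ₀ (fun k i => ξ k i ω) i k) ζ)
  have hF : ∀ ζ ω ω', (∀ j < i, ∀ k, ξ k (j + 1) ω = ξ k (j + 1) ω') → F ζ ω = F ζ ω' :=
    fun ζ ω ω' h => by simp only [F, belief_history h]
  have hFint : ∀ ζ, Integrable (F ζ) P := fun ζ => hξ.integrable_of_history (hF ζ)
  have hsplit : ∀ ω, F (ξ k (i + 1) ω) ω
      = ∑ ζ, {ω | ξ k (i + 1) ω = ζ}.indicator 1 ω * F ζ ω := by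
    intro ω
    simp [Set.indicator_apply]
  have hright : ∫ ω, F (ξ k (i + 1) ω) ω ∂P = ∫ ω, ∑ ζ, L k ζ θ₀ * F ζ ω ∂P := by
    simp_rw [hsplit]
    rw [integral_finsetSum, integral_finsetSum]
    · refine Finset.sum_congr rfl fun ζ _ => ?_
      rw [hξ.integral_indicator_mul_history (hF ζ) k ζ, integral_const_mul]
    · exact fun ζ _ => (hFint ζ).const_mul _
    · intro ζ _
      refine hξ.integrable_of_history (i := i + 1) fun ω ω' h => ?_
      rw [hF ζ ω ω' fun j hj => h j (by omega)]
      simp only [Set.indicator_apply, Set.mem_ofPred_eq, h i (by omega)]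
      rfl
  refine le_of_le_of_eq ?_ hright.symm
  refine integral_mono_ae (hξ.integrable_of_history (i := i) fun ω ω' h => ?_)
    (integrable_finsetSum _ fun ζ _ => (hFint ζ).const_mul _) ?_
  · rw [belief_history h]
  · filter_upwards [hpos] with ω hω
    have hs := isSubProbVec_belief (x := fun k i => ξ k i ω) h0 h1 hL0 hγ hμ₀ i k
    refine hellinger_le_kl (hL k θ₀) (predictive_nonneg (hL0 k) hs.1) ?_ fun ζ hζ => ?_
    · rw [sum_predictive (hL k)]
      exact hs.2
    · exact lt_of_lt_of_le (mul_pos hω hζ) (mul_le_predictive (hL0 k) hs.1 ζ θ₀)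

/-- The expected potential is bounded above and grows by the weighted errors, so these telescope;
positive `y k` and weights eventually above `c` remove the factors. -/
theorem summable_integral_forecastError (h0 : ∀ l k, 0 ≤ T l k) (h1 : ∀ k, ∑ l, T l k = 1)
    (hc : IsStronglyConnectedNet T)
    (hL : ∀ k θ, IsProbVec fun ζ => L k ζ θ) (hγ : ∀ k i, γ k i ∈ Set.Icc (0 : ℝ) 1)
    (hμ₀ : ∀ k, IsProbVec (μ₀ k)) (hξ : IsSignalProcess P L (fun _ => θ₀) ξ)
    (hprior : ∃ n, 0 < μ₀ n θ₀) (hw : ∀ k, ∃ c : ℝ, 0 < c ∧ ∀ᶠ i in atTop, c ≤ γ k i) (k : ι) :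
    Summable fun i => ∫ ω, forecastError L θ₀ (belief T L γ μ₀ (fun k i => ξ k i ω) i) k ∂P := by
  have hL0 : ∀ k ζ θ, 0 ≤ L k ζ θ := fun k ζ θ => (hL k θ).1 ζ
  obtain ⟨n, hn⟩ := hprior
  have : Nonempty ι := ⟨n⟩
  obtain ⟨y, hy, hTy⟩ := exists_pos_invariant h0 h1 hc.1
  obtain ⟨N, hN⟩ := eventually_belief_pos h0 h1 hc hL0 hγ hμ₀ hn
  have hgood := hξ.ae_likelihood_pos fun k ζ => hL0 k ζ θ₀
  set b : ℕ → Ω → ι → Θ → ℝ := fun i ω => belief T L γ μ₀ (fun k i => ξ k i ω) i with hb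
  set V : ℕ → ℝ := fun i => ∫ ω, ∑ k, y k * Real.log (b i ω k θ₀) ∂P with hV
  set e : ℕ → ι → ℝ := fun i k => ∫ ω, forecastError L θ₀ (b i ω) k ∂P with he
  have he0 : ∀ i k, 0 ≤ e i k := fun i k => integral_nonneg fun ω => forecastError_nonneg _ _
  set d : ℕ → ℝ := fun i => ∑ k, y k * (γ k (i + 1) * e i k) with hd
  have hterm : ∀ i k, 0 ≤ y k * (γ k (i + 1) * e i k) := fun i k =>
    mul_nonneg (hy k).le (mul_nonneg (hγ _ _).1 (he0 i k))
  have hd0 : ∀ i, 0 ≤ d i := fun i => Finset.sum_nonneg fun k _ => hterm i k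
  have hVint : ∀ i, Integrable (fun ω => ∑ k, y k * Real.log (b i ω k θ₀)) P := fun i =>
    hξ.integrable_of_history (i := i) fun ω ω' h => by simp only [hb, belief_history h]
  -- Before time `N` a belief in `θ₀` may be zero and its logarithm meaningless.
  have hstep : ∀ i ≥ N, V i + d i ≤ V (i + 1) := by
    intro i hi
    have hint : ∀ k, Integrable (fun ω => y k * (γ k (i + 1) * Real.log (L k (ξ k (i + 1) ω) θ₀ /
        predictive (L k) (b i ω k) (ξ k (i + 1) ω)))) P := fun k =>
      hξ.integrable_of_history (i := i + 1) fun ω ω' h => by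
        simp only [hb, belief_history fun j (hj : j < i) => h j (by omega)]
        rw [h i (by omega)]
    have hle : d i ≤ ∫ ω, ∑ k, y k * (γ k (i + 1) * Real.log (L k (ξ k (i + 1) ω) θ₀ /
        predictive (L k) (b i ω k) (ξ k (i + 1) ω))) ∂P := by
      rw [integral_finsetSum _ fun k _ => hint k]
      refine Finset.sum_le_sum fun k _ => ?_
      rw [integral_const_mul, integral_const_mul]
      refine mul_le_mul_of_nonneg_left (mul_le_mul_of_nonneg_left ?_ (hγ _ _).1) (hy k).le
      exact integral_forecastError_le h0 h1 hL hγ hμ₀ hξ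
        (hgood.mono fun ω hω => hN _ hω i hi k)
    calc V i + d i ≤ _ := add_le_add_right hle _
      _ = ∫ ω, (∑ k, y k * Real.log (b i ω k θ₀) +
          ∑ k, y k * (γ k (i + 1) * Real.log (L k (ξ k (i + 1) ω) θ₀ /
          predictive (L k) (b i ω k) (ξ k (i + 1) ω)))) ∂P :=
        (integral_add (hVint i) (integrable_finsetSum _ fun k _ => hint k)).symm
      _ ≤ V (i + 1) := by
        refine integral_mono_ae ((hVint i).add (integrable_finsetSum _ fun k _ => hint k))
          (hVint (i + 1)) ?_
        filter_upwards [hgood] with ω hω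
        exact potential_step h0 h1 hL0 hγ hμ₀ hy hTy (fun k => hω k _ (by omega))
          (hN _ hω i hi)
  have hVle : ∀ i, V i ≤ 0 := fun i => integral_nonpos fun ω =>
    Finset.sum_nonpos fun k _ => mul_nonpos_of_nonneg_of_nonpos (hy k).le
      (Real.log_nonpos ((isSubProbVec_belief h0 h1 hL0 hγ hμ₀ i k).1 θ₀)
        ((isSubProbVec_belief h0 h1 hL0 hγ hμ₀ i k).le_one θ₀))
  have htele : ∀ m, V N + ∑ j ∈ Finset.range m, d (j + N) ≤ V (m + N) := by
    intro m
    induction m with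
    | zero => simp
    | succ m ih =>
      rw [Finset.sum_range_succ]
      have := hstep (m + N) (by omega)
      rw [show m + 1 + N = m + N + 1 by omega]
      linarith
  have hsum : Summable d := (summable_nat_add_iff N).1 <|
    summable_of_sum_range_le (c := -V N) (fun j => hd0 _) fun m => by
      linarith [htele m, hVle (m + N)]
  obtain ⟨c, hc0, hcγ⟩ := hw k
  obtain ⟨M, hM⟩ := eventually_atTop.1 hcγ
  refine Summable.of_norm_bounded_eventually_nat (g := fun i => d i * (y k * c)⁻¹)
    (hsum.mul_right _) ?_
  filter_upwards [eventually_ge_atTop M] with i hi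
  rw [Real.norm_of_nonneg (he0 i k), ← div_eq_mul_inv, le_div_iff₀ (mul_pos (hy k) hc0)]
  calc e i k * (y k * c) = y k * (c * e i k) := by ring
    _ ≤ y k * (γ k (i + 1) * e i k) := mul_le_mul_of_nonneg_left
        (mul_le_mul_of_nonneg_right (hM _ (by omega)) (he0 i k)) (hy k).le
    _ ≤ d i := Finset.single_le_sum (f := fun k => y k * (γ k (i + 1) * e i k))
        (fun k _ => hterm i k) (Finset.mem_univ k)

/-- Almost surely, all agents of a strongly connected network learn the truth. -/
theorem ae_tendsto_belief [DecidableEq Θ]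
    (h0 : ∀ l k, 0 ≤ T l k) (h1 : ∀ k, ∑ l, T l k = 1) (hc : IsStronglyConnectedNet T)
    (hL : ∀ k θ, IsProbVec fun ζ => L k ζ θ) (hγ : ∀ k i, γ k i ∈ Set.Icc (0 : ℝ) 1)
    (hμ₀ : ∀ k, IsProbVec (μ₀ k)) (hξ : IsSignalProcess P L (fun _ => θ₀) ξ)
    (hprior : ∃ n, 0 < μ₀ n θ₀) (hw : ∀ k, ∃ c : ℝ, 0 < c ∧ ∀ᶠ i in atTop, c ≤ γ k i)
    (hid : ⋂ k, indistinguishable (L k) θ₀ = {θ₀})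
    (hprev : ∀ k, ∃ ζ, ∀ θ, θ ∉ indistinguishable (L k) θ₀ → L k ζ θ < L k ζ θ₀) :
    ∀ᵐ ω ∂P, ∀ k θ,
      Tendsto (fun i => belief T L γ μ₀ (fun k i => ξ k i ω) i k θ) atTop
        (𝓝 (if θ = θ₀ then 1 else 0)) ∧
      Tendsto (fun i => intermediateBelief (L k) (γ k (i + 1))
        (belief T L γ μ₀ (fun k i => ξ k i ω) i k) (ξ k (i + 1) ω) θ) atTop
        (𝓝 (if θ = θ₀ then 1 else 0)) := by
  have hL0 : ∀ k ζ θ, 0 ≤ L k ζ θ := fun k ζ θ => (hL k θ).1 ζ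
  have herr : ∀ᵐ ω ∂P, ∀ k, Tendsto (fun i =>
      forecastError L θ₀ (belief T L γ μ₀ (fun k i => ξ k i ω) i) k) atTop (𝓝 0) :=
    ae_all_iff.2 fun k => ae_tendsto_zero_of_summable_integral
      (fun i => hξ.integrable_of_history (i := i) fun ω ω' h => by rw [belief_history h])
      (fun i ω => forecastError_nonneg _ _)
      (summable_integral_forecastError h0 h1 hc hL hγ hμ₀ hξ hprior hw k)
  filter_upwards [herr, hξ.ae_likelihood_pos fun k ζ => hL0 k ζ θ₀] with ω hω hgood
  refine tendsto_belief_of_forecasts h0 h1 hc.1 hL hγ hμ₀ hid hprev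
    (fun k i => hgood k _ (by omega)) fun k ζ => ?_
  exact tendsto_of_hellinger (fun ζ => hL0 k ζ θ₀) (fun i ζ => predictive_nonneg (hL0 k)
    (isSubProbVec_belief h0 h1 hL0 hγ hμ₀ i k).1 ζ) (hω k) ζ

end Learning

/-! ### Sending sub-networks as autonomous networks, and the conclusion. -/

section SubNetwork

variable {S R : ℕ} {NS : Fin S → ℕ} {NR : Fin R → ℕ} {A : Matrix (Agent NS NR) (Agent NS NR) ℝ}

/-- Only the agents of its own sub-network influence a sending agent. -/
theorem IsWeakNetwork.sum_send (hA : IsWeakNetwork A) (s : Fin S) (n : Fin (NS s))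
    (f : Agent NS NR → ℝ) :
    ∑ l, A l (Sum.inl ⟨s, n⟩) * f l
      = ∑ m, sendBlock A s m n * f (Sum.inl ⟨s, m⟩) := by
  rw [Fintype.sum_sum_type, Fintype.sum_sigma]
  simp only [hA.recv_to_send, zero_mul, Finset.sum_const_zero, add_zero]
  refine Finset.sum_eq_single s (fun s' _ hs' => ?_) fun h => absurd (Finset.mem_univ s) h
  exact Finset.sum_eq_zero fun m _ => by rw [hA.send_to_send ⟨s', m⟩ ⟨s, n⟩ hs', zero_mul]

theorem IsWeakNetwork.sendBlock_col_sum (hA : IsWeakNetwork A) (s : Fin S) (n : Fin (NS s)) :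
    ∑ m, sendBlock A s m n = 1 := by
  have h := hA.sum_send s n fun _ => 1
  simp only [mul_one] at h
  rw [← h, hA.col_sum]

/-- A sending sub-network evolves autonomously. -/
theorem IsWeakNetwork.belief_send (hA : IsWeakNetwork A) {Θ : Type*} [Fintype Θ]
    {Z : Agent NS NR → Type*} (L : ∀ k, Z k → Θ → ℝ) (γ : Agent NS NR → ℕ → ℝ)
    (μ₀ : Agent NS NR → Θ → ℝ) (x : ∀ k, ℕ → Z k) (s : Fin S) (i : ℕ) (n : Fin (NS s)) :
    belief A L γ μ₀ x i (Sum.inl ⟨s, n⟩) =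
      belief (sendBlock A s) (fun n => L (Sum.inl ⟨s, n⟩)) (fun n => γ (Sum.inl ⟨s, n⟩))
        (fun n => μ₀ (Sum.inl ⟨s, n⟩)) (fun n => x (Sum.inl ⟨s, n⟩)) i n := by
  induction i generalizing n with
  | zero => rfl
  | succ i ih =>
    funext θ
    simp only [belief]
    rw [hA.sum_send s n fun l => intermediateBelief (L l) (γ l (i + 1))
      (belief A L γ μ₀ x i l) (x l (i + 1)) θ]
    simp only [ih]

theorem IsSignalProcess.restrict_send {Θ Ω : Type*} {Z : Agent NS NR → Type*}
    [MeasurableSpace Ω] [∀ k, MeasurableSpace (Z k)] {P : Measure Ω}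
    {L : ∀ k, Z k → Θ → ℝ} {θS : Fin S → Θ} {θR : Fin R → Θ} {ξ : ∀ k, ℕ → Ω → Z k}
    (hξ : IsSignalProcess P L (trueState θS θR) ξ) (s : Fin S) :
    IsSignalProcess P (fun n : Fin (NS s) => L (Sum.inl ⟨s, n⟩)) (fun _ => θS s)
      (fun n => ξ (Sum.inl ⟨s, n⟩)) where
  measurable n := hξ.measurable (Sum.inl ⟨s, n⟩)
  law n := hξ.law (Sum.inl ⟨s, n⟩)
  indep := hξ.indep.comp (fun _ (z : ∀ k, Z k) (n : Fin (NS s)) => z (Sum.inl ⟨s, n⟩))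
    fun _ => measurable_pi_lambda _ fun n : Fin (NS s) =>
      measurable_pi_apply (Sum.inl ⟨s, n⟩ : Agent NS NR)

end SubNetwork

theorem theorem4 {S R : ℕ} {NS : Fin S → ℕ} {NR : Fin R → ℕ}
    (A : Matrix (Agent NS NR) (Agent NS NR) ℝ) (hA : IsWeakNetwork A)
    {Θ : Type*} [Fintype Θ] [DecidableEq Θ]
    {Z : Agent NS NR → Type*} [∀ k, Fintype (Z k)] [∀ k, MeasurableSpace (Z k)]
    [∀ k, MeasurableSingletonClass (Z k)]
    (L : ∀ k, Z k → Θ → ℝ) (hL : ∀ k θ, IsProbVec (fun ζ => L k ζ θ))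
    (θS : Fin S → Θ) (θR : Fin R → Θ)
    (γ : Agent NS NR → ℕ → ℝ) (hγ : ∀ k i, γ k i ∈ Set.Icc (0 : ℝ) 1)
    (μ₀ : Agent NS NR → Θ → ℝ) (hμ₀ : ∀ k, IsProbVec (μ₀ k))
    {Ω : Type*} [MeasurableSpace Ω] (P : Measure Ω) [IsProbabilityMeasure P]
    (ξ : ∀ k, ℕ → Ω → Z k) (hξ : IsSignalProcess P L (trueState θS θR) ξ)
    (γmax : ℝ) :
    IsUnit (1 - blockRR A) ∧
    -- whenever the beliefs of the sending agents converge, and `γmax` bounds all weights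
    ((∀ k i, 1 ≤ i → γ k i ≤ γmax) →
      ∀ (ω : Ω) (θ : Θ) (v : SAgent NS → ℝ),
        Tendsto (fun i (k : SAgent NS) =>
          belief A L γ μ₀ (fun k i => ξ k i ω) i (Sum.inl k) θ) atTop (𝓝 v) →
        IsConfined A γmax v
          (fun i k => belief A L γ μ₀ (fun k i => ξ k i ω) i (Sum.inr k) θ)) ∧
    -- under the conditions on the sending agents, their beliefs do converge almost surely, and
    -- it is enough that `γmax` bounds the weights of the receiving agents
    (SendingConditions L θS γ μ₀ →
      (∀ (k : RAgent NR) i, 1 ≤ i → γ (Sum.inr k) i ≤ γmax) →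
      ∀ᵐ ω ∂P, ∀ θ : Θ, ∃ v : SAgent NS → ℝ,
        (∀ k, v k = if θ = θS k.1 then 1 else 0) ∧
        Tendsto (fun i (k : SAgent NS) =>
          belief A L γ μ₀ (fun k i => ξ k i ω) i (Sum.inl k) θ) atTop (𝓝 v) ∧
        IsConfined A γmax v
          (fun i k => belief A L γ μ₀ (fun k i => ξ k i ω) i (Sum.inr k) θ)) := by
  have hL0 : ∀ k ζ θ, 0 ≤ L k ζ θ := fun k ζ θ => (hL k θ).1 ζ
  have hs := fun (x : ∀ k, ℕ → Z k) i l =>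
    isSubProbVec_belief (x := x) hA.nonneg hA.col_sum hL0 hγ hμ₀ i l
  have hconf : ∀ (x : ∀ k, ℕ → Z k) (θ : Θ) (v : SAgent NS → ℝ),
      (∀ (k : RAgent NR) i, 1 ≤ i → γ (Sum.inr k) i ≤ γmax) →
      (∀ l : SAgent NS, ∀ ε > 0, ∀ᶠ i in atTop,
        |intermediateBelief (L (Sum.inl l)) (γ (Sum.inl l) (i + 1))
          (belief A L γ μ₀ x i (Sum.inl l)) (x (Sum.inl l) (i + 1)) θ - v l| ≤ γmax + ε) →
      IsConfined A γmax v (fun i k => belief A L γ μ₀ x i (Sum.inr k) θ) := by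
    intro x θ v hγR hψ
    refine hA.isConfined_of_recursion (μ := fun i k => belief A L γ μ₀ x i k θ)
      (ψ := fun i l => intermediateBelief (L l) (γ l (i + 1))
        (belief A L γ μ₀ x i l) (x l (i + 1)) θ)
      (fun i k => ?_) (fun i k => rfl) v hψ fun i l => ?_
    · rw [abs_of_nonneg ((hs x i k).1 θ)]
      exact (hs x i k).le_one θ
    · exact (abs_intermediateBelief_sub_le (hL0 _) (hs x i _) (hγ _ _).1 θ).trans
        (hγR l _ (by omega))
  refine ⟨hA.isUnit_one_sub, fun hγmax ω θ v hv => ?_, fun hS hγR => ?_⟩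
  -- Only the beliefs are known to converge, so a sending agent's own step costs up to `γmax`.
  · refine hconf _ θ v (fun k => hγmax (Sum.inr k)) fun l ε hε => ?_
    filter_upwards [Metric.tendsto_nhds.1 ((tendsto_pi_nhds.1 hv) l) ε hε] with i hi
    rw [Real.dist_eq] at hi
    have h := (abs_intermediateBelief_sub_le (ζ := ξ (Sum.inl l) (i + 1) ω) (hL0 (Sum.inl l))
      (hs (fun k i => ξ k i ω) i (Sum.inl l)) (hγ (Sum.inl l) (i + 1)).1 θ).trans
      (hγmax (Sum.inl l) (i + 1) (by omega))
    exact (abs_sub_le _ _ _).trans (add_le_add h hi.le)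
  · have hlearn := ae_all_iff.2 fun s : Fin S => ae_tendsto_belief
      (T := sendBlock A s) (fun l k => hA.nonneg _ _) (hA.sendBlock_col_sum s) (hA.send_connected s)
      (fun n => hL (Sum.inl ⟨s, n⟩)) (fun n => hγ (Sum.inl ⟨s, n⟩))
      (fun n => hμ₀ (Sum.inl ⟨s, n⟩)) (hξ.restrict_send s) (hS.prior_pos s)
      (fun n => hS.weight_pos ⟨s, n⟩) (hS.identifiable s) (fun n => hS.prevailing ⟨s, n⟩)
    filter_upwards [hlearn] with ω hω θ
    refine ⟨fun k => if θ = θS k.1 then 1 else 0, fun k => rfl, ?_, ?_⟩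
    · refine tendsto_pi_nhds.2 fun ⟨s, n⟩ => ?_
      simp only [hA.belief_send]
      exact (hω s n θ).1
    · intro k
      -- Here the intermediate beliefs of the sending agents converge too, so their weights need no
      -- bound by `γmax`. Its sign comes from the receiving agent `k`.
      have hγ0 : 0 ≤ γmax := (hγ (Sum.inr k) 1).1.trans (hγR k 1 le_rfl)
      refine hconf _ θ _ hγR (fun ⟨s, n⟩ ε hε => ?_) k
      simp only [hA.belief_send]
      filter_upwards [Metric.tendsto_nhds.1 (hω s n θ).2 ε hε] with i hi
      rw [Real.dist_eq] at hi
      exact hi.le.trans (le_add_of_nonneg_left hγ0)
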